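/- Let $\alpha\in\{1/2,1,2\}$, $s_n=\alpha n$ for $n\ge 1$, and $0\le k_0\le s_1=\alpha$. Let $\{Z_n:n\ge1\}$ be a Markov chain with $Z_1=k_0$ and one-step transitions, for $n\ge 1$, $$\Pr(Z_{n+1}-Z_n=1\mid Z_1,\dots,Z_n)=1-\frac{Z_n}{s_n},\qquad \Pr(Z_{n+1}-Z_n=0\mid Z_1,\dots,Z_n)=\frac{Z_n}{s_n}.$$ Then, for every $\lambda\in\mathbb R$, $E[e^{\lambda Z_n}]$ is finite for every $n\ge 1$ and the limit $$\Lambda(\lambda)=\lim_{n\to\infty}\frac1n\log E[e^{\lambda Z_n}]$$ exists and is finite. The function $\Lambda:\mathbb R\to\mathbb R$ is smooth ($C^\infty$), $\Lambda(0)=0$, and for $\lambda\ne0$ it is given as follows. - If $\alpha=1/2$: $\Lambda(\lambda)=\log\dfrac{\sqrt{e^\lambda-1}}{\arctan\sqrt{e^\lambda-1}}$ for $\lambda>0$, and $\Lambda(\lambda)=\log\dfrac{\sqrt{1-e^\lambda}}{\operatorname{arctanh}\sqrt{1-e^\lambda}}$ for $\lambda<0$. - If $\alpha=1$: $\Lambda(\lambda)=\log\dfrac{e^\lambda-1}{\lambda}$.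 - If $\alpha=2$: $\Lambda(\lambda)=\log\dfrac{(e^\lambda-1)^2}{2(e^\lambda-1-\lambda)}$. -/

import Mathlib

open MeasureTheory ProbabilityTheory Filter Topology

/-- The σ-algebra `σ(Z_1, …, Z_n)` generated by the first `n` steps of a real valued process
indexed from time `1` (the value `Z 0` is not used). -/
abbrev pastSigma {Ω : Type*} (Z : ℕ → Ω → ℝ) (n : ℕ) : MeasurableSpace Ω :=
  ⨆ j ∈ Set.Icc 1 n, MeasurableSpace.comap (Z j) inferInstance

/-- Under `μ`, `Z_1, Z_2, …` is the Markov chain started from `k₀` whose transition at each time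
`n ≥ 1` adds `1` to `Z_n` with probability `1 - Z_n / s_n` and leaves it unchanged with
probability `Z_n / s_n`; these are the conditional probabilities given `Z_1, …, Z_n`. -/
structure IsUrnChain {Ω : Type*} [MeasurableSpace Ω] (μ : Measure Ω) (s : ℕ → ℝ) (k₀ : ℝ)
    (Z : ℕ → Ω → ℝ) : Prop where
  measurable : ∀ n, 1 ≤ n → Measurable (Z n)
  init : ∀ᵐ ω ∂μ, Z 1 ω = k₀
  step_one : ∀ n, 1 ≤ n →
    μ⟦{ω | Z (n + 1) ω - Z n ω = 1} | pastSigma Z n⟧ =ᵐ[μ] fun ω => 1 - Z n ω / s n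
  step_zero : ∀ n, 1 ≤ n →
    μ⟦{ω | Z (n + 1) ω - Z n ω = 0} | pastSigma Z n⟧ =ᵐ[μ] fun ω => Z n ω / s n

/-! Write M_n(t) = E[e^{tZ_n}]. Conditioning on the past gives M_{n+1} = e^t M_n + (1 - e^t) M_n' /
(αn). On the half-line of sign σ put w = σ(e^{σt} - 1), h = w^α, and let D' = h/w with D(0+) = 0.
The recursion then says that φ_n = α^n M_{n+1}(σt) / h^{n+1} satisfies dφ_n/dD = -(n+1) φ_{n+1}. So
the φ_n are the signed Taylor coefficients of the one function φ_0 in the variable D, and φ_n^{1/n}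
→ 1/D is equivalent to Λ = log(h / (αD)).

The upper bound is a Cauchy estimate: all signed coefficients are positive, so each term of the
expansion at v, evaluated at u < v, is at most φ_0(u); then D(u) → 0 (`term_le`,
`exists_upper_bound`).

The lower bound must hold for every large N, not along a subsequence (`eventually_pow_le`).
Neighbouring φ_m(v) are comparable, so one abnormally small φ_N(v) makes a whole window around N
small. Expand φ_n at v and evaluate at a small u, with n ≈ N D(u)/D(v): the weights are negative
binomial and concentrate on that window, so φ_n(u) is too small. This contradicts the a priori bound
φ_n(u) ≥ c (e^{-2u}/D(u))^n, which follows from 0 ≤ Z_n ≤ k₀ + n and h ≤ αDe^u.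

For α = 1/2, 1, 2 the integral defining D is elementary, and the formulas extend smoothly through 0
by removing singularities. -/

/-- A sequence of positive functions on `(0, ∞)` which, in the variable `D`, are up to sign the
divided derivatives `f^{(n)} / n!` of a single completely monotone function. -/
structure IsDividedDerivSeq (φ : ℕ → ℝ → ℝ) (D D' : ℝ → ℝ) : Prop where
  pos : ∀ n t, 0 < t → 0 < φ n t
  deriv_pos : ∀ t, 0 < t → 0 < D' t
  hasDerivAt_var : ∀ t, 0 < t → HasDerivAt D (D' t) t
  hasDerivAt : ∀ n t, 0 < t → HasDerivAt (φ n) (-((n + 1) * φ (n + 1) t * D' t)) t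
  tendsto_zero : Tendsto D (𝓝[>] 0) (𝓝 0)

/-! ### Taylor bounds in the variable D. -/

namespace IsDividedDerivSeq

variable {φ : ℕ → ℝ → ℝ} {D D' : ℝ → ℝ}

lemma strictMonoOn (H : IsDividedDerivSeq φ D D') : StrictMonoOn D (Set.Ioi 0) := by
  apply strictMonoOn_of_deriv_pos (convex_Ioi 0)
  · exact fun t ht => (H.hasDerivAt_var t ht).continuousAt.continuousWithinAt
  · intro t ht
    rw [interior_Ioi] at ht
    rw [(H.hasDerivAt_var t ht).deriv]
    exact H.deriv_pos t ht

lemma var_lt (H : IsDividedDerivSeq φ D D') {u v : ℝ} (hu : 0 < u) (huv : u < v) : D u < D v :=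
  H.strictMonoOn hu (hu.trans huv) huv

lemma var_le (H : IsDividedDerivSeq φ D D') {u v : ℝ} (hu : 0 < u) (huv : u ≤ v) : D u ≤ D v :=
  H.strictMonoOn.monotoneOn hu (hu.trans_le huv) huv

lemma var_pos (H : IsDividedDerivSeq φ D D') {t : ℝ} (ht : 0 < t) : 0 < D t := by
  have h1 : D (t / 2) < D t := H.var_lt (by linarith) (by linarith)
  have h2 : 0 ≤ D (t / 2) := by
    apply le_of_tendsto H.tendsto_zero
    have : Set.Ioo (0 : ℝ) (t / 2) ∈ 𝓝[>] (0 : ℝ) := Ioo_mem_nhdsGT (by linarith)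
    filter_upwards [this] with x hx
    exact H.var_le hx.1 hx.2.le
  linarith

lemma exists_var_lt (H : IsDividedDerivSeq φ D D') {ε b : ℝ} (hε : 0 < ε) (hb : 0 < b) :
    ∃ u, 0 < u ∧ u < b ∧ D u < ε := by
  have h1 : ∀ᶠ x in 𝓝[>] (0 : ℝ), D x < ε := H.tendsto_zero.eventually_lt_const hε
  have h2 : Set.Ioo (0 : ℝ) b ∈ 𝓝[>] (0 : ℝ) := Ioo_mem_nhdsGT hb
  obtain ⟨x, hx, hx2⟩ := (h1.and h2).exists
  exact ⟨x, hx2.1, hx2.2, hx⟩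

lemma exists_var_eq (H : IsDividedDerivSeq φ D D') {v y : ℝ} (hv : 0 < v) (hy : 0 < y)
    (hyv : y < D v) : ∃ u, 0 < u ∧ u < v ∧ D u = y := by
  obtain ⟨a, ha, hav, hDa⟩ := H.exists_var_lt hy hv
  have hc : ContinuousOn D (Set.Icc a v) := fun t ht =>
    (H.hasDerivAt_var t (ha.trans_le ht.1)).continuousAt.continuousWithinAt
  obtain ⟨u, hu, rfl⟩ := intermediate_value_Ioo hav.le hc ⟨hDa, hyv⟩
  exact ⟨u, ha.trans hu.1, hu.2, rfl⟩

/-- The Taylor polynomial of `φ n`, centred at `x` and evaluated where the variable is `c`. -/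
lemma hasDerivAt_taylor (H : IsDividedDerivSeq φ D D') (n J : ℕ) (c : ℝ) {x : ℝ} (hx : 0 < x) :
    HasDerivAt
      (fun x => ∑ j ∈ Finset.range J, ((n + j).choose n : ℝ) * φ (n + j) x * (D x - c) ^ j)
      (-(J * ((n + J).choose n : ℝ) * φ (n + J) x * (D x - c) ^ (J - 1) * D' x)) x := by
  induction J with
  | zero => simpa using hasDerivAt_const x (0 : ℝ)
  | succ J ih =>
    simp only [Finset.sum_range_succ]
    have h1 := ((H.hasDerivAt (n + J) x hx).const_mul ((n + J).choose n : ℝ)).mul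
      (((H.hasDerivAt_var x hx).sub_const c).pow J)
    refine (ih.add h1).congr_deriv ?_
    -- This identity makes the derivative telescope: only the term of highest order survives.
    have h2 : ((n + J).choose n : ℝ) * (n + J + 1) = ((n + J + 1).choose n : ℝ) * (J + 1) := by
      have := Nat.choose_mul_succ_eq (n + J) n
      rw [show n + J + 1 - n = J + 1 by omega] at this
      exact_mod_cast this
    rw [← add_assoc n J 1]
    simp only [Nat.add_sub_cancel, Pi.pow_apply]
    push_cast
    linear_combination (-(φ (n + J + 1) x) * (D x - c) ^ J * D' x) * h2

/-- With the evaluation point fixed, moving the centre from u to v only decreases the polynomial,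
since its derivative is a single nonpositive term; at centre u it is φ n u, or 0 when J = 0. -/
lemma taylor_le (H : IsDividedDerivSeq φ D D') (n J : ℕ) {u v : ℝ} (hu : 0 < u) (huv : u ≤ v) :
    ∑ j ∈ Finset.range J, ((n + j).choose n : ℝ) * φ (n + j) v * (D v - D u) ^ j ≤ φ n u := by
  set T := fun x => ∑ j ∈ Finset.range J, ((n + j).choose n : ℝ) * φ (n + j) x * (D x - D u) ^ j
  have hT : AntitoneOn T (Set.Icc u v) := by
    apply antitoneOn_of_deriv_nonpos (convex_Icc u v)
    · exact fun x hx => (H.hasDerivAt_taylor n J (D u) (hu.trans_le hx.1)).continuousAt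
        |>.continuousWithinAt
    · exact fun x hx => by
        rw [interior_Icc] at hx
        exact (H.hasDerivAt_taylor n J (D u) (hu.trans hx.1)).differentiableAt
          |>.differentiableWithinAt
    · intro x hx
      rw [interior_Icc] at hx
      have hx0 := hu.trans hx.1
      rw [(H.hasDerivAt_taylor n J (D u) hx0).deriv]
      have h1 := H.var_lt hu hx.1
      have h2 := H.pos (n + J) x hx0
      have h3 := H.deriv_pos x hx0
      have h4 : 0 ≤ D x - D u := by linarith
      simp only [Left.neg_nonpos_iff]
      positivity
  refine (hT ⟨le_rfl, huv⟩ ⟨huv, le_rfl⟩ huv).trans ?_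
  cases J with
  | zero => simpa [T] using (H.pos n u hu).le
  | succ J => simp [T, Finset.sum_range_succ', sub_self]

/-- Plays the role of Cauchy's estimate: one term of a nonnegative sum. -/
lemma term_le (H : IsDividedDerivSeq φ D D') (n J : ℕ) {u v : ℝ} (hu : 0 < u) (huv : u ≤ v) :
    ((n + J).choose n : ℝ) * φ (n + J) v * (D v - D u) ^ J ≤ φ n u := by
  refine le_trans ?_ (H.taylor_le n (J + 1) hu huv)
  apply Finset.single_le_sum
    (f := fun j => ((n + j).choose n : ℝ) * φ (n + j) v * (D v - D u) ^ j) ?_ (by simp)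
  intro i _
  have h2 := H.pos (n + i) v (hu.trans_le huv)
  have h4 : 0 ≤ D v - D u := by linarith [H.var_le hu huv]
  positivity

/-- The Cauchy estimate from a point a left of u controls the loss when the centre moves, giving a
remainder geometric in J. -/
lemma le_taylor_add (H : IsDividedDerivSeq φ D D') (n J : ℕ) {a u v : ℝ} (ha : 0 < a)
    (hau : a < u) (huv : u ≤ v) :
    φ n u ≤ ∑ j ∈ Finset.range J, ((n + j).choose n : ℝ) * φ (n + j) v * (D v - D u) ^ j +
      φ n a * ((D v - D a) / (D u - D a)) * ((D v - D u) / (D v - D a)) ^ J := by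
  have hu := ha.trans hau
  have hDau := H.var_lt ha hau
  rcases Nat.eq_zero_or_pos J with rfl | hJ
  · simp only [Finset.range_zero, Finset.sum_empty, pow_zero, zero_add, mul_one]
    have h1 : φ n u ≤ φ n a := by simpa using H.term_le n 0 ha hau.le
    have h2 : 1 ≤ (D v - D a) / (D u - D a) := by
      rw [one_le_div (by linarith)]
      linarith [H.var_le hu huv]
    nlinarith [H.pos n a ha]
  -- The power ((D x - D u)/(D x - D a))^J has derivative J (D x - D u)^(J-1) (D u - D a) D' x / (D
  -- x - D a)^(J+1). This C makes it outweigh the Taylor derivative for all x ≤ v, so F is monotone.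
  set C := φ n a * ((D v - D a) / (D u - D a)) with hC
  set F := fun x => (∑ j ∈ Finset.range J, ((n + j).choose n : ℝ) * φ (n + j) x * (D x - D u) ^ j)
    + C * ((D x - D u) / (D x - D a)) ^ J with hF
  have hder : ∀ x ∈ Set.Icc u v, HasDerivAt F
      (-(J * ((n + J).choose n : ℝ) * φ (n + J) x * (D x - D u) ^ (J - 1) * D' x) +
        C * (J * ((D x - D u) / (D x - D a)) ^ (J - 1) *
          ((D' x * (D x - D a) - (D x - D u) * D' x) / (D x - D a) ^ 2))) x := by
    intro x hx
    have hx0 := hu.trans_le hx.1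
    have h1 := H.hasDerivAt_taylor n J (D u) hx0
    have h2 := H.hasDerivAt_var x hx0
    have h3 : D x - D a ≠ 0 := by
      have := H.var_lt ha (hau.trans_le hx.1)
      exact ne_of_gt (by linarith)
    exact h1.add ((((h2.sub_const (D u)).div (h2.sub_const (D a)) h3).pow J).const_mul C)
  have hmono : MonotoneOn F (Set.Icc u v) := by
    apply monotoneOn_of_deriv_nonneg (convex_Icc u v)
    · exact fun x hx => (hder x hx).continuousAt.continuousWithinAt
    · intro x hx
      exact (hder x (interior_subset hx)).differentiableAt.differentiableWithinAt
    · intro x hx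
      have hx' := interior_subset hx
      rw [interior_Icc] at hx
      rw [(hder x hx').deriv]
      have hx0 := hu.trans hx.1
      have ht := H.term_le n J ha (hau.trans hx.1).le
      have h1 : 0 < D x - D a := by linarith [H.var_lt ha (hau.trans hx.1)]
      have h2 : 0 < D x - D u := by linarith [H.var_lt hu hx.1]
      have h3 : 0 < D u - D a := by linarith
      have h4 : D x - D a ≤ D v - D a := by linarith [H.var_le hx0 hx.2.le]
      have h5 := H.deriv_pos x hx0
      have h6 := H.pos n a ha
      have hd : D' x * (D x - D a) - (D x - D u) * D' x = D' x * (D u - D a) := by ring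
      rw [hd]
      have hK : ((n + J).choose n : ℝ) * φ (n + J) x ≤ φ n a / (D x - D a) ^ J := by
        rwa [le_div_iff₀ (by positivity)]
      have hCle : φ n a * ((D x - D a) / (D u - D a)) ≤ C := by
        rw [hC]; gcongr
      have e1 : φ n a * ((D x - D a) / (D u - D a)) *
          (J * ((D x - D u) / (D x - D a)) ^ (J - 1) *
          ((D' x * (D u - D a)) / (D x - D a) ^ 2)) =
          J * (φ n a / (D x - D a) ^ J) * (D x - D u) ^ (J - 1) * D' x := by
        obtain ⟨k, rfl⟩ : ∃ k, J = k + 1 := ⟨J - 1, by omega⟩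
        simp only [Nat.add_sub_cancel, div_pow]
        field_simp
        ring
      have e2 : (J : ℝ) * ((n + J).choose n : ℝ) * φ (n + J) x * (D x - D u) ^ (J - 1) * D' x ≤
          J * (φ n a / (D x - D a) ^ J) * (D x - D u) ^ (J - 1) * D' x := by
        rw [mul_assoc (J : ℝ)]
        gcongr
      have e3 : φ n a * ((D x - D a) / (D u - D a)) *
          (J * ((D x - D u) / (D x - D a)) ^ (J - 1) *
          ((D' x * (D u - D a)) / (D x - D a) ^ 2)) ≤ C *
          (J * ((D x - D u) / (D x - D a)) ^ (J - 1) *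
          ((D' x * (D u - D a)) / (D x - D a) ^ 2)) := by
        gcongr
      linarith
  have := hmono ⟨le_rfl, huv⟩ ⟨huv, le_rfl⟩ huv
  refine le_trans (le_of_eq ?_) this
  obtain ⟨k, rfl⟩ : ∃ k, J = k + 1 := ⟨J - 1, by omega⟩
  simp [hF, Finset.sum_range_succ']

/-- `term_le` at order 0, with u so small that D v - D u still exceeds 1 / r. -/
lemma exists_upper_bound (H : IsDividedDerivSeq φ D D') {v r : ℝ} (hv : 0 < v)
    (hr : 1 / D v < r) : ∃ C, 0 < C ∧ ∀ n, φ n v ≤ C * r ^ n := by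
  have hd := H.var_pos hv
  have hr0 : 0 < r := lt_trans (by positivity) hr
  have hrd : 1 / r < D v := by
    rw [div_lt_iff₀ hd] at hr
    rw [div_lt_iff₀ hr0]; linarith
  obtain ⟨u, hu, huv, hDu⟩ := H.exists_var_lt (sub_pos.2 hrd) hv
  refine ⟨φ 0 u, H.pos 0 u hu, fun n => ?_⟩
  have h := H.term_le 0 n hu huv.le
  simp only [zero_add, Nat.choose_zero_right, Nat.cast_one, one_mul] at h
  have h1 : (1 / r) ^ n ≤ (D v - D u) ^ n :=
    pow_le_pow_left₀ (by positivity) (by linarith) n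
  have h2 : φ n v * (1 / r) ^ n ≤ φ 0 u :=
    (mul_le_mul_of_nonneg_left h1 (H.pos n v hv).le).trans h
  rw [one_div, inv_pow, ← div_eq_mul_inv, div_le_iff₀ (by positivity)] at h2
  exact h2

lemma sum_choose_mul_geometric_le (n J : ℕ) {y : ℝ} (hy : 0 ≤ y) (hy1 : y < 1) :
    ∑ j ∈ Finset.range J, ((n + j).choose n : ℝ) * y ^ j ≤ 1 / (1 - y) ^ (n + 1) := by
  have h := hasSum_choose_mul_geometric_of_norm_lt_one n
    (r := y) (by rwa [Real.norm_of_nonneg hy])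
  have h2 := h.summable.sum_le_tsum (Finset.range J) (fun j _ => by positivity)
  rw [h.tsum_eq] at h2
  simpa only [add_comm n] using h2

/-- Splitting of the Taylor expansion of `φ n` at `v` into a lower part, a window and a remainder. -/
lemma le_split (H : IsDividedDerivSeq φ D D') {n J₁ J₂ : ℕ} (hJ : J₁ ≤ J₂) {a u b v θ : ℝ}
    (ha : 0 < a) (hau : a < u) (hub : u < b) (hbv : b < v) (hθ : 0 ≤ θ)
    (hwin : ∀ m, n + J₁ ≤ m → m < n + J₂ → φ m v ≤ θ / D v ^ m) :
    φ n u ≤ ((D v - D u) / (D v - D b)) ^ J₁ * φ n b + θ * (D v / D u) / D u ^ n +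
      φ n a * ((D v - D a) / (D u - D a)) * ((D v - D u) / (D v - D a)) ^ J₂ := by
  have hu := ha.trans hau
  have hb := hu.trans hub
  have hv := hb.trans hbv
  have hDu := H.var_pos hu
  have hDv := H.var_pos hv
  have hub' := H.var_lt hu hub
  have hbv' := H.var_lt hb hbv
  refine (H.le_taylor_add n J₂ ha hau (hub.trans hbv).le).trans ?_
  gcongr
  rw [← Finset.sum_range_add_sum_Ico _ hJ]
  gcongr
  -- Exponential tilting: replacing D u by D b costs a ratio above 1 to the power j ≤ J₁, and the
  -- tilted sum is at most φ n b.
  · refine le_trans ?_ (mul_le_mul_of_nonneg_left (H.taylor_le n J₁ hb hbv.le)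
      (pow_nonneg (div_nonneg (by linarith) (by linarith)) _))
    rw [Finset.mul_sum]
    apply Finset.sum_le_sum
    intro j hj
    have hjJ : j ≤ J₁ := (Finset.mem_range.1 hj).le
    have hφ := H.pos (n + j) v hv
    have h1 : ((D v - D u) / (D v - D b)) ^ j ≤ ((D v - D u) / (D v - D b)) ^ J₁ := by
      apply pow_le_pow_right₀ _ hjJ
      rw [one_le_div (by linarith)]; linarith
    have h2 : (D v - D u) ^ j = ((D v - D u) / (D v - D b)) ^ j * (D v - D b) ^ j := by
      rw [← mul_pow, div_mul_cancel₀ _ (by linarith)]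
    rw [h2]
    have h3 : 0 < (D v - D b) ^ j := pow_pos (by linarith) _
    calc _ = ((D v - D u) / (D v - D b)) ^ j *
        (((n + j).choose n : ℝ) * φ (n + j) v * (D v - D b) ^ j) := by ring
      _ ≤ _ := by gcongr
  -- In the window a factor θ / D v ^ n splits off, leaving part of a negative binomial series of
  -- ratio 1 - D u / D v.
  · have hy0 : 0 ≤ (D v - D u) / D v := div_nonneg (by linarith) hDv.le
    have hy1 : (D v - D u) / D v < 1 := by rw [div_lt_one hDv]; linarith
    have hs := sum_choose_mul_geometric_le n J₂ hy0 hy1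
    have h1y : 1 - (D v - D u) / D v = D u / D v := by field_simp; ring
    rw [h1y] at hs
    calc _ ≤ ∑ j ∈ Finset.Ico J₁ J₂, θ / D v ^ n *
          (((n + j).choose n : ℝ) * ((D v - D u) / D v) ^ j) := by
          apply Finset.sum_le_sum
          intro j hj
          rw [Finset.mem_Ico] at hj
          have hw := hwin (n + j) (by omega) (by omega)
          have h3 : 0 ≤ (D v - D u) ^ j := pow_nonneg (by linarith) _
          calc _ ≤ ((n + j).choose n : ℝ) * (θ / D v ^ (n + j)) * (D v - D u) ^ j := by gcongr
            _ = _ := by rw [div_pow, pow_add]; field_simp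
      _ ≤ ∑ j ∈ Finset.range J₂, θ / D v ^ n *
          (((n + j).choose n : ℝ) * ((D v - D u) / D v) ^ j) := by
          apply Finset.sum_le_sum_of_subset_of_nonneg
          · intro j hj
            rw [Finset.mem_Ico] at hj
            exact Finset.mem_range.2 hj.2
          · intros; positivity
      _ ≤ θ / D v ^ n * (1 / (D u / D v) ^ (n + 1)) := by
          rw [← Finset.mul_sum]; gcongr
      _ = _ := by rw [div_pow]; field_simp; ring

end IsDividedDerivSeq

/-! ### Tail estimates and the exact exponential rate. -/

namespace IsDividedDerivSeq

variable {φ : ℕ → ℝ → ℝ} {D D' : ℝ → ℝ}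

lemma le_pow_natDist_mul {f : ℕ → ℝ} {Q : ℝ} (hQ : 1 ≤ Q)
    (h₁ : ∀ n, f (n + 1) ≤ Q * f n) (h₂ : ∀ n, f n ≤ Q * f (n + 1)) (m n : ℕ) :
    f m ≤ Q ^ (Nat.dist m n) * f n := by
  have key : ∀ m k, f (m + k) ≤ Q ^ k * f m ∧ f m ≤ Q ^ k * f (m + k) := by
    intro m k
    induction k with
    | zero => simp
    | succ k ih =>
      have hQ0 : 0 ≤ Q := by linarith
      constructor
      · calc f (m + k + 1) ≤ Q * f (m + k) := h₁ _
          _ ≤ Q * (Q ^ k * f m) := mul_le_mul_of_nonneg_left ih.1 hQ0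
          _ = _ := by ring
      · calc f m ≤ Q ^ k * f (m + k) := ih.2
          _ ≤ Q ^ k * (Q * f (m + k + 1)) := mul_le_mul_of_nonneg_left (h₂ _) (by positivity)
          _ = _ := by rw [add_assoc]; ring
  rcases le_total m n with h | h
  · rw [Nat.dist_eq_sub_of_le h]
    obtain ⟨k, rfl⟩ := Nat.exists_eq_add_of_le h
    simpa using (key m k).2
  · rw [Nat.dist_eq_sub_of_le_right h]
    obtain ⟨k, rfl⟩ := Nat.exists_eq_add_of_le h
    simpa using (key n k).1

/-- Bound for the lower tail of the expansion: the saving is `exp (-3 η² n / 8)`. -/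
lemma lower_tail_le {d δ η C p : ℝ} {n J : ℕ} (hδ : 0 < δ) (hη : 0 < η)
    (hη' : η ≤ 1 / 4) (hδd : δ ≤ η * d) (hJ : (J : ℝ) ≤ (1 - 2 * η) * (n * d / δ)) (hC : 0 < C)
    (hp : p ≤ C * (Real.exp (η ^ 2 / 8) / ((1 + η) * δ)) ^ n) :
    ((d - δ) / (d - (1 + η) * δ)) ^ J * p ≤ C * Real.exp (-(3 * η ^ 2 / 8) * n) / δ ^ n := by
  have hd : 0 < d := by
    by_contra h
    nlinarith
  have hden : 0 < d - (1 + η) * δ := by nlinarith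
  have h1 : (d - δ) / (d - (1 + η) * δ) ≤ Real.exp (η * δ / (d - (1 + η) * δ)) := by
    refine le_trans (le_of_eq ?_) (Real.add_one_le_exp _)
    rw [div_add_one hden.ne']
    congr 1
    ring
  have h2 : ((d - δ) / (d - (1 + η) * δ)) ^ J ≤ Real.exp (n * (η * (1 - η))) := by
    refine (pow_le_pow_left₀ (div_nonneg (by nlinarith) hden.le) h1 J).trans ?_
    rw [← Real.exp_nat_mul]
    apply Real.exp_le_exp.2
    calc (J : ℝ) * (η * δ / (d - (1 + η) * δ))
        ≤ ((1 - 2 * η) * (n * d / δ)) * (η * δ / (d - (1 + η) * δ)) := by gcongr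
      _ = n * η * (((1 - 2 * η) * d) / (d - (1 + η) * δ)) := by field_simp
      _ ≤ n * η * (1 - η) := by
          gcongr
          rw [div_le_iff₀ hden]
          nlinarith
      _ = _ := by ring
  have h3 : (1 + η)⁻¹ ≤ Real.exp (-(η - η ^ 2 / 2)) := by
    rw [Real.exp_neg]
    apply inv_anti₀ (Real.exp_pos _)
    rw [← Real.le_log_iff_exp_le (by linarith)]
    refine le_trans ?_ (Real.le_log_one_add_of_nonneg hη.le)
    rw [le_div_iff₀ (by linarith)]
    nlinarith [pow_pos hη 3]
  have h4 : (Real.exp (η ^ 2 / 8) / ((1 + η) * δ)) ^ n ≤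
      Real.exp (n * (η ^ 2 / 8 - (η - η ^ 2 / 2))) / δ ^ n := by
    rw [Real.exp_nat_mul, ← div_pow]
    apply pow_le_pow_left₀ (by positivity)
    rw [sub_eq_add_neg (η ^ 2 / 8), Real.exp_add]
    calc _ = Real.exp (η ^ 2 / 8) * (1 + η)⁻¹ / δ := by field_simp
      _ ≤ _ := by gcongr
  have hb : 0 ≤ C * (Real.exp (η ^ 2 / 8) / ((1 + η) * δ)) ^ n := by positivity
  calc _ ≤ Real.exp (n * (η * (1 - η))) * (C * (Real.exp (η ^ 2 / 8) / ((1 + η) * δ)) ^ n) := by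
        refine (mul_le_mul_of_nonneg_left hp ?_).trans (mul_le_mul_of_nonneg_right h2 hb)
        exact pow_nonneg (div_nonneg (by nlinarith) hden.le) _
    _ ≤ Real.exp (n * (η * (1 - η))) *
        (C * (Real.exp (n * (η ^ 2 / 8 - (η - η ^ 2 / 2))) / δ ^ n)) := by gcongr
    _ = C * (Real.exp (n * (η * (1 - η))) *
        Real.exp (n * (η ^ 2 / 8 - (η - η ^ 2 / 2)))) / δ ^ n := by ring
    _ = _ := by
        rw [← Real.exp_add]
        congr 3
        ring

/-- Bound for the remainder of the expansion: the saving is `exp (-3 η² n / 8)`. -/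
lemma upper_tail_le {d δ η C p : ℝ} {n J : ℕ} (hδ : 0 < δ) (hη : 0 < η)
    (hη' : η ≤ 1 / 4) (hδd : δ ≤ η * d) (hJ : (1 + 3 * η) * (n * d / δ) ≤ J) (hC : 0 < C)
    (hp : p ≤ C * (Real.exp (η ^ 2 / 8) / ((1 - η) * δ)) ^ n) :
    p * ((d - δ) / (d - (1 - η) * δ)) ^ J ≤ C * Real.exp (-(3 * η ^ 2 / 8) * n) / δ ^ n := by
  have hd : 0 < d := by
    by_contra h
    nlinarith
  have hden : 0 < d - (1 - η) * δ := by nlinarith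
  have h0 : 0 ≤ (d - δ) / (d - (1 - η) * δ) := div_nonneg (by nlinarith) hden.le
  have h1 : (d - δ) / (d - (1 - η) * δ) ≤ Real.exp (-(η * δ / d)) := by
    refine le_trans ?_ (Real.add_one_le_exp _)
    rw [div_le_iff₀ hden]
    have : (-(η * δ / d) + 1) * (d - (1 - η) * δ) = (d - δ) + (1 - η) * η * δ ^ 2 / d := by
      field_simp
      ring
    rw [this]
    have : 0 ≤ (1 - η) * η * δ ^ 2 / d := by
      have : 0 < 1 - η := by linarith
      positivity
    linarith
  have h2 : ((d - δ) / (d - (1 - η) * δ)) ^ J ≤ Real.exp (n * (-(η * (1 + 3 * η)))) := by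
    refine (pow_le_pow_left₀ h0 h1 J).trans ?_
    rw [← Real.exp_nat_mul]
    apply Real.exp_le_exp.2
    have : n * (η * (1 + 3 * η)) ≤ J * (η * δ / d) := by
      calc n * (η * (1 + 3 * η)) = ((1 + 3 * η) * (n * d / δ)) * (η * δ / d) := by field_simp
        _ ≤ _ := by gcongr
    linarith
  have h3 : (1 - η)⁻¹ ≤ Real.exp (η + 2 * η ^ 2) := by
    have h5 : 0 < 1 - η := by linarith
    rw [inv_le_comm₀ h5 (Real.exp_pos _), ← Real.exp_neg, ← Real.le_log_iff_exp_le h5]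
    refine le_trans ?_ (Real.one_sub_inv_le_log_of_pos h5)
    have : (1 - η)⁻¹ ≤ 1 + η + 2 * η ^ 2 := by
      rw [inv_le_iff_one_le_mul₀ h5]
      nlinarith [pow_pos hη 2, pow_pos hη 3]
    linarith
  have h4 : (Real.exp (η ^ 2 / 8) / ((1 - η) * δ)) ^ n ≤
      Real.exp (n * (η ^ 2 / 8 + (η + 2 * η ^ 2))) / δ ^ n := by
    have h5 : 0 < 1 - η := by linarith
    rw [Real.exp_nat_mul, ← div_pow]
    apply pow_le_pow_left₀ (by positivity)
    rw [Real.exp_add]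
    calc _ = Real.exp (η ^ 2 / 8) * (1 - η)⁻¹ / δ := by field_simp
      _ ≤ _ := by gcongr
  calc _ ≤ (C * (Real.exp (n * (η ^ 2 / 8 + (η + 2 * η ^ 2))) / δ ^ n)) *
        Real.exp (n * (-(η * (1 + 3 * η)))) := by
        apply mul_le_mul (hp.trans (by gcongr)) h2 (pow_nonneg h0 _) (by positivity)
    _ = C * (Real.exp (n * (η ^ 2 / 8 + (η + 2 * η ^ 2))) *
        Real.exp (n * (-(η * (1 + 3 * η))))) / δ ^ n := by ring
    _ ≤ _ := by
        rw [← Real.exp_add]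
        gcongr
        have : (0 : ℝ) ≤ n * η ^ 2 := by positivity
        linarith

/-- If the `N`-th term is small, so are all terms in a window around `N`. -/
lemma window_le {f : ℕ → ℝ} {Q r d L s η K : ℝ} {m N : ℕ} (hd : 0 < d)
    (hQ : 1 ≤ Q) (hr : 0 < r)
    (h₁ : ∀ n, f (n + 1) ≤ Q * f n) (h₂ : ∀ n, f n ≤ Q * f (n + 1))
    (hL : Q * (d + 1 / d) ≤ Real.exp L) (hs : r * d = Real.exp (-s))
    (hη : 4 * η * L ≤ s / 2) (hL0 : 0 ≤ L)
    (hdist : (Nat.dist m N : ℝ) ≤ 4 * η * N + K) (hN : f N ≤ r ^ N) :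
    f m ≤ Real.exp (L * K) * Real.exp (-(s / 2) * N) / d ^ m := by
  rw [le_div_iff₀ (by positivity)]
  -- The base d + 1 / d dominates both d and 1 / d, so it serves on either side of N.
  have hd1 : d ^ m ≤ (d + 1 / d) ^ (Nat.dist m N) * d ^ N := by
    rcases le_total m N with h | h
    · rw [Nat.dist_eq_sub_of_le h]
      obtain ⟨k, rfl⟩ := Nat.exists_eq_add_of_le h
      have : (1 / d) ^ k ≤ (d + 1 / d) ^ k :=
        pow_le_pow_left₀ (by positivity) (by linarith) k
      calc d ^ m = (1 / d) ^ k * d ^ (m + k) := by rw [pow_add, div_pow]; field_simp; simp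
        _ ≤ (d + 1 / d) ^ k * d ^ (m + k) := by gcongr
        _ = _ := by simp
    · rw [Nat.dist_eq_sub_of_le_right h]
      obtain ⟨k, rfl⟩ := Nat.exists_eq_add_of_le h
      have h3 : 0 < 1 / d := by positivity
      have : d ^ k ≤ (d + 1 / d) ^ k :=
        pow_le_pow_left₀ (by positivity) (by linarith) k
      calc d ^ (N + k) = d ^ k * d ^ N := by ring
        _ ≤ (d + 1 / d) ^ k * d ^ N := by gcongr
        _ = _ := by simp
  calc f m * d ^ m ≤ (Q ^ (Nat.dist m N) * r ^ N) * ((d + 1 / d) ^ (Nat.dist m N) * d ^ N) := by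
        apply mul_le_mul _ hd1 (by positivity) (by positivity)
        refine (le_pow_natDist_mul hQ h₁ h₂ m N).trans ?_
        gcongr
    _ = (Q * (d + 1 / d)) ^ (Nat.dist m N) * (r * d) ^ N := by rw [mul_pow, mul_pow]; ring
    _ ≤ (Real.exp L) ^ (Nat.dist m N) * (r * d) ^ N := by gcongr
    _ = Real.exp ((Nat.dist m N : ℝ) * L + N * -s) := by
        rw [hs, ← Real.exp_nat_mul, ← Real.exp_nat_mul, Real.exp_add]
    _ ≤ Real.exp (L * K + -(s / 2) * N) := by
        apply Real.exp_le_exp.2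
        have h5 : (Nat.dist m N : ℝ) * L ≤ (4 * η * N + K) * L := by gcongr
        have h6 : 4 * η * L * N ≤ s / 2 * N := by gcongr
        linarith
    _ = _ := Real.exp_add _ _

-- Contradiction argument: if φ N v were below r ^ N, the three pieces of `le_split` would bound φ n
-- u by a constant times exp(-3η²n/8) / D(u)^n, while `hlow` gives at least a constant times
-- exp(-η²n/8) / D(u)^n.
set_option maxHeartbeats 800000 in
theorem eventually_pow_le (H : IsDividedDerivSeq φ D D') {v Q r : ℝ} (hv : 0 < v) (hQ : 1 ≤ Q)
    (h₁ : ∀ n, φ (n + 1) v ≤ Q * φ n v) (h₂ : ∀ n, φ n v ≤ Q * φ (n + 1) v)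
    (hlow : ∀ u, 0 < u → ∃ c, 0 < c ∧ ∀ n, c * (Real.exp (-(2 * u)) / D u) ^ n ≤ φ n u)
    (hr : 0 < r) (hrD : r < 1 / D v) : ∀ᶠ N in atTop, r ^ N ≤ φ N v := by
  have hd := H.var_pos hv
  set d := D v with hd_def
  set s := -Real.log (r * d) with hs_def
  have hrd : r * d < 1 := by rwa [lt_div_iff₀ hd] at hrD
  have hs : 0 < s := by
    have := Real.log_neg (by positivity) hrd
    linarith
  have hs' : r * d = Real.exp (-s) := by
    rw [hs_def, neg_neg, Real.exp_log (by positivity)]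
  set L := Q * (d + 1 / d) with hL_def
  have hL0 : 0 < L := by positivity
  have hL : Q * (d + 1 / d) ≤ Real.exp L := by linarith [Real.add_one_le_exp L]
  -- Here s is the assumed deficit per step and L the cost of moving one index; a window of relative
  -- width 4η costs at most half the deficit.
  set η := min (1 / 4) (s / (8 * L)) with hη_def
  have hη : 0 < η := by positivity
  have hη4 : η ≤ 1 / 4 := min_le_left _ _
  have hηL : 4 * η * L ≤ s / 2 := by
    have : η ≤ s / (8 * L) := min_le_right _ _
    rw [le_div_iff₀ (by positivity)] at this
    linarith
  -- u < η²/16 keeps the loss e^{-2u} below the tail saving. D u < ηd makes n negligible against N,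
  -- and D u < sd makes the window saving beat exp(-3η²n/8).
  obtain ⟨u, hu, hub, hDu⟩ := H.exists_var_lt (ε := min (η * d) (s * d)) (by positivity)
    (b := min (η ^ 2 / 16) v) (by positivity)
  have huv : u < v := hub.trans_le (min_le_right _ _)
  have hu8 : 2 * u ≤ η ^ 2 / 8 := by linarith [hub.le.trans (min_le_left _ _)]
  have hδ := H.var_pos hu
  set δ := D u with hδ_def
  have hδη : δ ≤ η * d := hDu.le.trans (min_le_left _ _)
  have hδs : δ ≤ s * d := hDu.le.trans (min_le_right _ _)
  have hδ4 : δ ≤ d / 4 := hδη.trans (by linarith [mul_le_mul_of_nonneg_right hη4 hd.le])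
  have hηδ : η * δ ≤ δ / 4 := by linarith [mul_le_mul_of_nonneg_right hη4 hδ.le]
  have hηδ0 : 0 < η * δ := by positivity
  obtain ⟨b, hb, hbv, hDb⟩ := H.exists_var_eq hv (y := (1 + η) * δ) (by positivity) (by linarith)
  obtain ⟨a, ha, hau, hDa⟩ := H.exists_var_eq hu (y := (1 - η) * δ)
    (mul_pos (by linarith) hδ) (by linarith)
  have hub : u < b := by
    rw [← H.strictMonoOn.lt_iff_lt hu hb, hDb, ← hδ_def]
    linarith
  have hexp : 1 < Real.exp (η ^ 2 / 8) := Real.one_lt_exp_iff.2 (by positivity)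
  obtain ⟨Cb, hCb, hCb'⟩ := H.exists_upper_bound hb
    (r := Real.exp (η ^ 2 / 8) / ((1 + η) * δ)) (by rw [hDb]; gcongr)
  have hη1 : 0 < 1 - η := by linarith
  obtain ⟨Ca, hCa, hCa'⟩ := H.exists_upper_bound ha
    (r := Real.exp (η ^ 2 / 8) / ((1 - η) * δ)) (by rw [hDa]; gcongr)
  obtain ⟨c, hc, hc'⟩ := hlow u hu
  set K := d / δ + 1 with hK
  set Ctot := Cb + Ca * ((d - D a) / (δ - D a)) + Real.exp (L * K) * (d / δ) with hCtot
  have hn : Tendsto (fun N : ℕ => ⌊(N : ℝ) * (δ / d)⌋₊) atTop atTop :=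
    tendsto_nat_floor_atTop.comp
      (tendsto_natCast_atTop_atTop.atTop_mul_const (by positivity))
  have hlim : Tendsto (fun n : ℕ => Ctot * Real.exp (-(η ^ 2 / 4) * n)) atTop (𝓝 0) := by
    have : Tendsto (fun n : ℕ => Real.exp (-(η ^ 2 / 4) * n)) atTop (𝓝 0) := by
      apply Real.tendsto_exp_atBot.comp
      exact tendsto_natCast_atTop_atTop.const_mul_atTop_of_neg (by
        have : 0 < η ^ 2 / 4 := by positivity
        linarith)
    simpa using this.const_mul Ctot
  filter_upwards [hn.eventually (hlim.eventually_lt_const hc)] with N hN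
  by_contra hcon
  have hNr : φ N v ≤ r ^ N := (not_le.1 hcon).le
  -- Chosen so that the negative binomial weights peak where n + j ≈ n d / δ ≈ N.
  set n := ⌊(N : ℝ) * (δ / d)⌋₊ with hn_def
  have hn1 : (n : ℝ) ≤ N * (δ / d) := Nat.floor_le (by positivity)
  have hn2 : (N : ℝ) * (δ / d) < n + 1 := Nat.lt_floor_add_one _
  have hX1 : n * d / δ ≤ N := by
    rw [div_le_iff₀ hδ]
    have := mul_le_mul_of_nonneg_right hn1 hd.le
    have e : (N : ℝ) * (δ / d) * d = N * δ := by field_simp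
    linarith
  have hX2 : N ≤ n * d / δ + d / δ := by
    rw [← add_div, le_div_iff₀ hδ]
    have := mul_le_mul_of_nonneg_right hn2.le hd.le
    have e : (N : ℝ) * (δ / d) * d = N * δ := by field_simp
    linarith
  set X := n * d / δ with hX
  have hX0 : 0 ≤ X := by positivity
  have hnX : n ≤ η * X := by
    have : (n : ℝ) = δ / d * X := by rw [hX]; field_simp
    rw [this]
    gcongr
    rwa [div_le_iff₀ hd]
  set J₁ := ⌊(1 - 2 * η) * X⌋₊
  set J₂ := ⌈(1 + 3 * η) * X⌉₊
  have hJ1 : (J₁ : ℝ) ≤ (1 - 2 * η) * X := Nat.floor_le (mul_nonneg (by linarith) hX0)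
  have hJ1' : (1 - 2 * η) * X < J₁ + 1 := Nat.lt_floor_add_one _
  have hJ2 : (1 + 3 * η) * X ≤ J₂ := Nat.le_ceil _
  have hJ2' : (J₂ : ℝ) < (1 + 3 * η) * X + 1 := Nat.ceil_lt_add_one (by positivity)
  have hJ : J₁ ≤ J₂ := by
    have : (J₁ : ℝ) ≤ J₂ := by linarith [mul_nonneg hη.le hX0]
    exact_mod_cast this
  have hwin : ∀ m, n + J₁ ≤ m → m < n + J₂ →
      φ m v ≤ (Real.exp (L * K) * Real.exp (-(s / 2) * N)) / d ^ m := by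
    intro m hm1 hm2
    refine window_le hd hQ hr h₁ h₂ hL hs' hηL hL0.le ?_ hNr
    have hm1' : (n : ℝ) + J₁ ≤ m := by exact_mod_cast hm1
    have hm2' : (m : ℝ) ≤ n + J₂ := by exact_mod_cast hm2.le
    have hηX : η * X ≤ η * N := by gcongr
    have hηN : 0 ≤ η * N := by positivity
    have hdδ : 0 < d / δ := by positivity
    have hn0 : (0 : ℝ) ≤ n := by positivity
    rcases le_total m N with h | h
    · rw [Nat.dist_eq_sub_of_le h, Nat.cast_sub h]
      linarith
    · rw [Nat.dist_eq_sub_of_le_right h, Nat.cast_sub h]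
      linarith
  have hsplit := H.le_split hJ ha hau hub hbv (by positivity) hwin
  rw [hDb, ← hd_def, ← hδ_def] at hsplit
  have hlt := lower_tail_le hδ hη hη4 hδη hJ1 hCb (hCb' n)
  have hut := upper_tail_le hδ hη hη4 hδη hJ2 hCa (hCa' n)
  have hD1 : 0 < (d - D a) / (δ - D a) := by
    rw [hDa]
    apply div_pos <;> linarith
  have hmid : Real.exp (L * K) * Real.exp (-(s / 2) * N) * (d / δ) / δ ^ n ≤
      Real.exp (L * K) * (d / δ) * Real.exp (-(3 * η ^ 2 / 8) * n) / δ ^ n := by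
    rw [mul_right_comm]
    have h1 : (n : ℝ) ≤ s * N := by
      have : (n : ℝ) = δ / d * X := by rw [hX]; field_simp
      rw [this]
      have : δ / d ≤ s := by rwa [div_le_iff₀ hd]
      gcongr
    have h2 : η ^ 2 ≤ 1 := pow_le_one₀ hη.le (by linarith)
    have h3 : (0 : ℝ) ≤ n := by positivity
    have hE : Real.exp (-(s / 2) * N) ≤ Real.exp (-(3 * η ^ 2 / 8) * n) :=
      Real.exp_le_exp.2 (by linarith [mul_le_mul_of_nonneg_right h2 h3])
    gcongr
  have hut' : φ n a * ((d - D a) / (δ - D a)) * ((d - δ) / (d - D a)) ^ J₂ ≤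
      (d - D a) / (δ - D a) * (Ca * Real.exp (-(3 * η ^ 2 / 8) * n) / δ ^ n) := by
    calc _ = (d - D a) / (δ - D a) * (φ n a * ((d - δ) / (d - D a)) ^ J₂) := by ring
      _ ≤ _ := by
        rw [← hDa] at hut
        gcongr
  have hall : φ n u ≤ Ctot * Real.exp (-(3 * η ^ 2 / 8) * n) / δ ^ n := by
    refine hsplit.trans ((add_le_add (add_le_add hlt hmid) hut').trans (le_of_eq ?_))
    rw [hCtot]; ring
  have hlow' : c * Real.exp (-(η ^ 2 / 8) * n) / δ ^ n ≤ φ n u := by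
    refine le_trans ?_ (hc' n)
    rw [div_pow, ← Real.exp_nat_mul, mul_div_assoc]
    have h3 : (0 : ℝ) ≤ n := by positivity
    have hE : Real.exp (-(η ^ 2 / 8) * n) ≤ Real.exp (n * -(2 * u)) :=
      Real.exp_le_exp.2 (by linarith [mul_le_mul_of_nonneg_right hu8 h3])
    gcongr
  have hfin : c * Real.exp (-(η ^ 2 / 8) * n) ≤ Ctot * Real.exp (-(3 * η ^ 2 / 8) * n) := by
    have := hlow'.trans hall
    rwa [div_le_div_iff_of_pos_right (by positivity)] at this
  have e : Real.exp (-(3 * η ^ 2 / 8) * n) =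
      Real.exp (-(η ^ 2 / 4) * n) * Real.exp (-(η ^ 2 / 8) * n) := by
    rw [← Real.exp_add]; congr 1; ring
  rw [e, ← mul_assoc] at hfin
  have := le_of_mul_le_mul_right hfin (Real.exp_pos _)
  linarith

theorem tendsto_log_div (H : IsDividedDerivSeq φ D D') {v Q : ℝ} (hv : 0 < v) (hQ : 1 ≤ Q)
    (h₁ : ∀ n, φ (n + 1) v ≤ Q * φ n v) (h₂ : ∀ n, φ n v ≤ Q * φ (n + 1) v)
    (hlow : ∀ u, 0 < u → ∃ c, 0 < c ∧ ∀ n, c * (Real.exp (-(2 * u)) / D u) ^ n ≤ φ n u) :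
    Tendsto (fun n : ℕ => Real.log (φ n v) / n) atTop (𝓝 (-Real.log (D v))) := by
  have hd := H.var_pos hv
  rw [tendsto_order]
  constructor
  · intro y hy
    obtain ⟨z, hyz, hz⟩ := exists_between hy
    have hz' : Real.exp z < 1 / D v := by
      rw [← Real.lt_log_iff_exp_lt (by positivity), one_div, Real.log_inv]
      exact hz
    filter_upwards [H.eventually_pow_le hv hQ h₁ h₂ hlow (Real.exp_pos z) hz',
      eventually_gt_atTop 0] with n hn hn0
    have hn0' : (0 : ℝ) < n := by exact_mod_cast hn0
    rw [lt_div_iff₀ hn0']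
    rw [← Real.exp_nat_mul, ← Real.le_log_iff_exp_le (H.pos n v hv)] at hn
    nlinarith
  · intro y hy
    obtain ⟨z, hz, hzy⟩ := exists_between hy
    have hz' : 1 / D v < Real.exp z := by
      rw [← Real.log_lt_iff_lt_exp (by positivity), one_div, Real.log_inv]
      exact hz
    obtain ⟨C, hC, hC'⟩ := H.exists_upper_bound hv hz'
    have hlim : Tendsto (fun n : ℕ => Real.log C / n) atTop (𝓝 0) :=
      tendsto_const_nhds.div_atTop tendsto_natCast_atTop_atTop
    filter_upwards [hlim.eventually_lt_const (sub_pos.2 hzy), eventually_gt_atTop 0] with n hn hn0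
    have hn0' : (0 : ℝ) < n := by exact_mod_cast hn0
    rw [div_lt_iff₀ hn0'] at hn ⊢
    have h3 := Real.log_le_log (H.pos n v hv) (hC' n)
    rw [Real.log_mul hC.ne' (by positivity), Real.log_pow, Real.log_exp] at h3
    linarith

end IsDividedDerivSeq

/-! ### Moment generating functions of the chain. -/

namespace IsUrnChain

lemma measurable_pastSigma {Ω : Type*} {Z : ℕ → Ω → ℝ} {n : ℕ} (hn : 1 ≤ n) :
    Measurable[pastSigma Z n] (Z n) := by
  have h : MeasurableSpace.comap (Z n) inferInstance ≤ pastSigma Z n :=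
    le_iSup₂_of_le (f := fun j (_ : j ∈ Set.Icc 1 n) => MeasurableSpace.comap (Z j) inferInstance)
      n ⟨hn, le_rfl⟩ le_rfl
  exact (comap_measurable (Z n)).mono h le_rfl

variable {Ω : Type*} [mΩ : MeasurableSpace Ω] {μ : Measure Ω}
  {s : ℕ → ℝ} {k₀ : ℝ} {Z : ℕ → Ω → ℝ}

lemma pastSigma_le (hZ : IsUrnChain μ s k₀ Z) (n : ℕ) : pastSigma Z n ≤ mΩ :=
  iSup₂_le fun j hj => (hZ.measurable j hj.1).comap_le

lemma measurableSet_step (hZ : IsUrnChain μ s k₀ Z) {n : ℕ} (hn : 1 ≤ n) (c : ℝ) :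
    MeasurableSet {ω | Z (n + 1) ω - Z n ω = c} :=
  ((hZ.measurable (n + 1) (by omega)).sub (hZ.measurable n hn)) (measurableSet_singleton c)

variable [IsProbabilityMeasure μ]

/-- The two conditional probabilities add up to 1, so after integration the two disjoint events
exhaust the space. -/
lemma step_ae (hZ : IsUrnChain μ s k₀ Z) {n : ℕ} (hn : 1 ≤ n) :
    ∀ᵐ ω ∂μ, Z (n + 1) ω - Z n ω = 1 ∨ Z (n + 1) ω - Z n ω = 0 := by
  set A := {ω | Z (n + 1) ω - Z n ω = 1} with hA
  set B := {ω | Z (n + 1) ω - Z n ω = 0} with hB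
  have hAm : MeasurableSet A := hZ.measurableSet_step hn 1
  have hBm : MeasurableSet B := hZ.measurableSet_step hn 0
  have h1 : ∫ ω, (1 - Z n ω / s n) ∂μ = μ.real A := by
    rw [← integral_congr_ae (hZ.step_one n hn), integral_condExp (hZ.pastSigma_le n),
      integral_indicator hAm]
    simp
  have h0 : ∫ ω, Z n ω / s n ∂μ = μ.real B := by
    rw [← integral_congr_ae (hZ.step_zero n hn), integral_condExp (hZ.pastSigma_le n),
      integral_indicator hBm]
    simp
  have hi1 : Integrable (fun ω => 1 - Z n ω / s n) μ :=
    integrable_condExp.congr (hZ.step_one n hn)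
  have hi0 : Integrable (fun ω => Z n ω / s n) μ :=
    integrable_condExp.congr (hZ.step_zero n hn)
  have hsum : μ.real A + μ.real B = 1 := by
    rw [← h1, ← h0, ← integral_add hi1 hi0]
    simp
  have hdisj : Disjoint A B := by
    rw [Set.disjoint_left]
    intro ω h1 h2
    simp only [hA, hB, Set.mem_ofPred_eq] at h1 h2
    linarith
  have hU : μ.real (A ∪ B) = 1 := by rw [measureReal_union hdisj hBm, hsum]
  have hU' : μ (A ∪ B) = 1 := by
    rw [measureReal_def] at hU
    rw [← ENNReal.toReal_eq_one_iff, hU]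
  exact (mem_ae_iff_prob_eq_one (hAm.union hBm)).2 hU'

lemma mem_Icc_ae (hZ : IsUrnChain μ s k₀ Z) {n : ℕ} (hn : 1 ≤ n) :
    ∀ᵐ ω ∂μ, Z n ω ∈ Set.Icc k₀ (k₀ + n) := by
  induction n, hn using Nat.le_induction with
  | base =>
    filter_upwards [hZ.init] with ω hω
    simp [hω]
  | succ n hn ih =>
    filter_upwards [ih, hZ.step_ae hn] with ω hω hs
    push_cast
    rcases hs with h | h <;> constructor <;> linarith [hω.1, hω.2]

lemma integrable_exp (hZ : IsUrnChain μ s k₀ Z) {n : ℕ} (hn : 1 ≤ n) (t : ℝ) :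
    Integrable (fun ω => Real.exp (t * Z n ω)) μ :=
  integrable_exp_mul_of_mem_Icc (hZ.measurable n hn).aemeasurable (hZ.mem_Icc_ae hn)

lemma integral_mul_indicator (hZ : IsUrnChain μ s k₀ Z) {n : ℕ} (hn : 1 ≤ n) {A : Set Ω}
    (hA : MeasurableSet A) {p : Ω → ℝ} (hp : μ⟦A | pastSigma Z n⟧ =ᵐ[μ] p) (t : ℝ) :
    Integrable (fun ω => Real.exp (t * Z n ω) * A.indicator (fun _ => (1 : ℝ)) ω) μ ∧
    Integrable (fun ω => Real.exp (t * Z n ω) * p ω) μ ∧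
    ∫ ω, Real.exp (t * Z n ω) * A.indicator (fun _ => (1 : ℝ)) ω ∂μ =
      ∫ ω, Real.exp (t * Z n ω) * p ω ∂μ := by
  have hexp : Measurable[pastSigma Z n] (fun ω => Real.exp (t * Z n ω)) :=
    Real.measurable_exp.comp ((measurable_pastSigma hn).const_mul t)
  have hsm : StronglyMeasurable[pastSigma Z n] (fun ω => Real.exp (t * Z n ω)) :=
    hexp.stronglyMeasurable
  have hind : Integrable (A.indicator (fun _ => (1 : ℝ))) μ :=
    (integrable_const 1).indicator hA
  have hprod : Integrable
      ((fun ω => Real.exp (t * Z n ω)) * A.indicator (fun _ => (1 : ℝ))) μ := by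
    have : (fun ω => Real.exp (t * Z n ω)) * A.indicator (fun _ => (1 : ℝ)) =
        A.indicator (fun ω => Real.exp (t * Z n ω)) := by
      ext ω
      by_cases h : ω ∈ A <;> simp [h]
    rw [this]
    exact (hZ.integrable_exp hn t).indicator hA
  have hpull := condExp_mul_of_stronglyMeasurable_left hsm hprod hind
  have hpull' : μ[(fun ω => Real.exp (t * Z n ω)) * A.indicator (fun _ => (1 : ℝ)) | pastSigma Z n]
      =ᵐ[μ] fun ω => Real.exp (t * Z n ω) * p ω := by
    filter_upwards [hpull, hp] with ω h1 h2
    rw [h1, Pi.mul_apply, h2]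
  refine ⟨hprod, integrable_condExp.congr hpull', ?_⟩
  rw [← integral_congr_ae hpull', integral_condExp (hZ.pastSigma_le n)]
  rfl

/-- Split e^{tZ_{n+1}} over the two possible steps and condition on the past. The remaining integral
is the derivative of the generating function, so this is a differential recursion. -/
lemma mgf_succ (hZ : IsUrnChain μ s k₀ Z) {n : ℕ} (hn : 1 ≤ n) (t : ℝ) :
    mgf (Z (n + 1)) μ t = Real.exp t * mgf (Z n) μ t +
      (1 - Real.exp t) / s n * ∫ ω, Z n ω * Real.exp (t * Z n ω) ∂μ := by
  obtain ⟨hi1, hj1, he1⟩ :=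
    hZ.integral_mul_indicator hn (hZ.measurableSet_step hn 1) (hZ.step_one n hn) t
  obtain ⟨hi0, hj0, he0⟩ :=
    hZ.integral_mul_indicator hn (hZ.measurableSet_step hn 0) (hZ.step_zero n hn) t
  have hsplit : ∀ᵐ ω ∂μ, Real.exp (t * Z (n + 1) ω) =
      Real.exp t * (Real.exp (t * Z n ω) *
        {ω | Z (n + 1) ω - Z n ω = 1}.indicator (fun _ => (1 : ℝ)) ω) +
      Real.exp (t * Z n ω) * {ω | Z (n + 1) ω - Z n ω = 0}.indicator (fun _ => (1 : ℝ)) ω := by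
    filter_upwards [hZ.step_ae hn] with ω hω
    rcases hω with h | h
    · have e : t * Z (n + 1) ω = t + t * Z n ω := by linear_combination t * h
      simp [Set.indicator, h, e, Real.exp_add]
    · have e : t * Z (n + 1) ω = t * Z n ω := by linear_combination t * h
      simp [Set.indicator, h, e]
  have hpt : ∀ ω, Real.exp t * (Real.exp (t * Z n ω) * (1 - Z n ω / s n)) +
      Real.exp (t * Z n ω) * (Z n ω / s n) = Real.exp t * Real.exp (t * Z n ω) +
      (1 - Real.exp t) * (Real.exp (t * Z n ω) * (Z n ω / s n)) := fun ω => by ring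
  have hc : (1 - Real.exp t) / s n * ∫ ω, Z n ω * Real.exp (t * Z n ω) ∂μ =
      (1 - Real.exp t) * ∫ ω, Real.exp (t * Z n ω) * (Z n ω / s n) ∂μ := by
    rw [← integral_const_mul, ← integral_const_mul]
    congr 1
    ext ω
    ring
  rw [hc]
  simp only [mgf]
  rw [integral_congr_ae hsplit, integral_add (hi1.const_mul _) hi0, integral_const_mul, he1, he0,
    ← integral_const_mul, ← integral_add (hj1.const_mul _) hj0]
  simp_rw [hpt]
  rw [integral_add ((hZ.integrable_exp hn t).const_mul _) (hj0.const_mul _), integral_const_mul,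
    integral_const_mul]

lemma hasDerivAt_mgf (hZ : IsUrnChain μ s k₀ Z) {n : ℕ} (hn : 1 ≤ n) {t : ℝ} (ht : t ≠ 0)
    (hs : s n ≠ 0) :
    HasDerivAt (mgf (Z n) μ)
      (s n * (mgf (Z (n + 1)) μ t - Real.exp t * mgf (Z n) μ t) / (1 - Real.exp t)) t := by
  have huniv : integrableExpSet (Z n) μ = Set.univ :=
    Set.eq_univ_of_forall fun t => hZ.integrable_exp hn t
  have h := ProbabilityTheory.hasDerivAt_mgf (X := Z n) (μ := μ) (t := t) (by simp [huniv])
  refine h.congr_deriv ?_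
  have he : 1 - Real.exp t ≠ 0 := by
    rw [sub_ne_zero]
    exact fun h => ht (Real.exp_eq_one_iff t |>.1 h.symm)
  rw [hZ.mgf_succ hn]
  beta_reduce
  generalize ∫ ω, Z n ω * Real.exp (t * Z n ω) ∂μ = I
  field_simp
  ring

lemma mgf_pos' (hZ : IsUrnChain μ s k₀ Z) {n : ℕ} (hn : 1 ≤ n) (t : ℝ) : 0 < mgf (Z n) μ t :=
  mgf_pos (hZ.integrable_exp hn t)

lemma exp_le_mgf (hZ : IsUrnChain μ s k₀ Z) (hk : 0 ≤ k₀) {n : ℕ} (hn : 1 ≤ n) (t : ℝ) :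
    Real.exp (-(|t| * (k₀ + n))) ≤ mgf (Z n) μ t := by
  have h : ∫ _, Real.exp (-(|t| * (k₀ + n))) ∂μ ≤ mgf (Z n) μ t := by
    apply integral_mono_ae (integrable_const _) (hZ.integrable_exp hn t)
    filter_upwards [hZ.mem_Icc_ae hn] with ω hω
    apply Real.exp_le_exp.2
    have h0 : 0 ≤ Z n ω := hk.trans hω.1
    have h1 : |t| * Z n ω ≤ |t| * (k₀ + n) := mul_le_mul_of_nonneg_left hω.2 (abs_nonneg t)
    nlinarith [neg_abs_le t]
  simpa using h

/-- Steps lie in {0, 1}; this supplies the comparability of neighbouring coefficients. -/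
lemma mgf_succ_le (hZ : IsUrnChain μ s k₀ Z) {n : ℕ} (hn : 1 ≤ n) (t : ℝ) :
    mgf (Z (n + 1)) μ t ≤ Real.exp |t| * mgf (Z n) μ t ∧
      mgf (Z n) μ t ≤ Real.exp |t| * mgf (Z (n + 1)) μ t := by
  simp only [mgf]
  rw [← integral_const_mul, ← integral_const_mul]
  constructor
  · apply integral_mono_ae (hZ.integrable_exp (by omega) t)
      ((hZ.integrable_exp hn t).const_mul _)
    filter_upwards [hZ.step_ae hn] with ω hω
    simp only [← Real.exp_add]
    apply Real.exp_le_exp.2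
    rcases hω with h | h
    · linear_combination t * h + le_abs_self t
    · linear_combination t * h + abs_nonneg t
  · apply integral_mono_ae (hZ.integrable_exp hn t)
      ((hZ.integrable_exp (by omega) t).const_mul _)
    filter_upwards [hZ.step_ae hn] with ω hω
    simp only [← Real.exp_add]
    apply Real.exp_le_exp.2
    rcases hω with h | h
    · linear_combination -t * h + neg_le_abs t
    · linear_combination -t * h + abs_nonneg t

end IsUrnChain

/-! ### The change of variable and the limit for general α > 0. -/

namespace IsUrnChain

lemma sign_mul_exp_sub_one_pos {σ : ℝ} (hσ : σ = 1 ∨ σ = -1) {t : ℝ} (ht : 0 < t) :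
    0 < σ * (Real.exp (σ * t) - 1) := by
  rcases hσ with rfl | rfl
  · have := Real.one_lt_exp_iff.2 ht
    rw [one_mul, one_mul]
    linarith
  · have := Real.exp_lt_one_iff.2 (neg_lt_zero.2 ht)
    rw [neg_one_mul, neg_one_mul]
    linarith

lemma hasDerivAt_sign_mul_exp_sub_one {σ : ℝ} (hσ : σ = 1 ∨ σ = -1) (t : ℝ) :
    HasDerivAt (fun t => σ * (Real.exp (σ * t) - 1)) (Real.exp (σ * t)) t := by
  have h := ((((hasDerivAt_id t).const_mul σ).exp).sub_const 1).const_mul σ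
  refine h.congr_deriv ?_
  rcases hσ with rfl | rfl <;> simp

lemma hasDerivAt_rpow_sign_mul_exp_sub_one {σ α : ℝ} (hσ : σ = 1 ∨ σ = -1) {t : ℝ} (ht : 0 < t) :
    HasDerivAt (fun t => (σ * (Real.exp (σ * t) - 1)) ^ α)
      (α * Real.exp (σ * t) *
        ((σ * (Real.exp (σ * t) - 1)) ^ α / (σ * (Real.exp (σ * t) - 1)))) t := by
  have hw := sign_mul_exp_sub_one_pos hσ ht
  refine ((hasDerivAt_sign_mul_exp_sub_one hσ t).rpow_const (p := α)
    (Or.inl hw.ne')).congr_deriv ?_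
  rw [Real.rpow_sub_one hw.ne']
  ring

variable {Ω : Type*} [mΩ : MeasurableSpace Ω] {μ : Measure Ω} [IsProbabilityMeasure μ]
  {α k₀ : ℝ} {Z : ℕ → Ω → ℝ}

/-- The normalised moment generating functions are the divided derivatives of one function. -/
lemma isDividedDerivSeq (hZ : IsUrnChain μ (fun n => α * n) k₀ Z) (hα : 0 < α) {σ : ℝ}
    (hσ : σ = 1 ∨ σ = -1) {D : ℝ → ℝ}
    (hD : ∀ t, 0 < t → HasDerivAt D
      ((σ * (Real.exp (σ * t) - 1)) ^ α / (σ * (Real.exp (σ * t) - 1))) t)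
    (hD0 : Tendsto D (𝓝[>] 0) (𝓝 0)) :
    IsDividedDerivSeq (fun n t => α ^ n * mgf (Z (n + 1)) μ (σ * t) /
        ((σ * (Real.exp (σ * t) - 1)) ^ α) ^ (n + 1)) D
      (fun t => (σ * (Real.exp (σ * t) - 1)) ^ α / (σ * (Real.exp (σ * t) - 1))) where
  pos n t ht := by
    have hw := sign_mul_exp_sub_one_pos hσ ht
    have := hZ.mgf_pos' (n := n + 1) (by omega) (σ * t)
    positivity
  deriv_pos t ht := by
    have hw := sign_mul_exp_sub_one_pos hσ ht
    positivity
  hasDerivAt_var := hD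
  tendsto_zero := hD0
  hasDerivAt n t ht := by
    have hw := sign_mul_exp_sub_one_pos hσ ht
    have hσ0 : σ ≠ 0 := by rcases hσ with rfl | rfl <;> norm_num
    have hσ2 : σ * σ = 1 := by rcases hσ with rfl | rfl <;> norm_num
    have hm := hZ.hasDerivAt_mgf (n := n + 1) (by omega) (t := σ * t) (mul_ne_zero hσ0 ht.ne')
      (by positivity)
    have hm' := hm.comp t ((hasDerivAt_id t).const_mul σ)
    have hh := (hasDerivAt_rpow_sign_mul_exp_sub_one (α := α) hσ ht).pow (n + 1)
    have hpos : 0 < (σ * (Real.exp (σ * t) - 1)) ^ α := by positivity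
    have hq := (hm'.const_mul (α ^ n)).div hh (pow_ne_zero _ hpos.ne')
    refine hq.congr_deriv ?_
    have he : 1 - Real.exp (σ * t) = -(σ * (σ * (Real.exp (σ * t) - 1))) := by
      linear_combination -(1 - Real.exp (σ * t)) * hσ2
    simp only [Pi.pow_apply, Function.comp_apply, Nat.add_sub_cancel, mul_one]
    rw [he]
    clear hq hm' hm hh he
    generalize σ * (Real.exp (σ * t) - 1) = w at hw hpos ⊢
    generalize w ^ α = h at hpos ⊢
    push_cast
    field_simp
    ring

/-- With h the left side, h' = α e^{σt} D' ≤ α e^t D', so the difference of the two sides is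
monotone and tends to 0 at 0. It converts powers of h into powers of D in the a priori lower bound.
-/
lemma rpow_le_mul_exp {σ : ℝ} (hσ : σ = 1 ∨ σ = -1) (hα : 0 < α) {D : ℝ → ℝ}
    (hD : ∀ t, 0 < t → HasDerivAt D
      ((σ * (Real.exp (σ * t) - 1)) ^ α / (σ * (Real.exp (σ * t) - 1))) t)
    (hpos : ∀ t, 0 < t → 0 < D t)
    (hD0 : Tendsto D (𝓝[>] 0) (𝓝 0)) {t : ℝ} (ht : 0 < t) :
    (σ * (Real.exp (σ * t) - 1)) ^ α ≤ α * D t * Real.exp t := by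
  set g := fun t => α * D t * Real.exp t - (σ * (Real.exp (σ * t) - 1)) ^ α with hg
  have hder : ∀ x, 0 < x → HasDerivAt g
      (α * ((σ * (Real.exp (σ * x) - 1)) ^ α / (σ * (Real.exp (σ * x) - 1))) * Real.exp x +
        α * D x * Real.exp x - α * Real.exp (σ * x) *
        ((σ * (Real.exp (σ * x) - 1)) ^ α / (σ * (Real.exp (σ * x) - 1)))) x := fun x hx =>
    (((hD x hx).const_mul α).mul (Real.hasDerivAt_exp x)).sub
      (hasDerivAt_rpow_sign_mul_exp_sub_one hσ hx)
  have hmono : MonotoneOn g (Set.Ioi 0) := by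
    apply monotoneOn_of_deriv_nonneg (convex_Ioi 0)
    · exact fun x hx => (hder x hx).continuousAt.continuousWithinAt
    · rw [interior_Ioi]
      exact fun x hx => (hder x hx).differentiableAt.differentiableWithinAt
    · intro x hx
      rw [interior_Ioi] at hx
      have hx : 0 < x := hx
      rw [(hder x hx).deriv]
      have hw := sign_mul_exp_sub_one_pos hσ hx
      have h1 : 0 < (σ * (Real.exp (σ * x) - 1)) ^ α / (σ * (Real.exp (σ * x) - 1)) := by
        positivity
      have h2 : Real.exp (σ * x) ≤ Real.exp x := by
        apply Real.exp_le_exp.2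
        rcases hσ with rfl | rfl <;> linarith
      have h3 := hpos x hx
      have h4 : 0 < α * D x * Real.exp x := by positivity
      have h5 := mul_le_mul_of_nonneg_left h2 (mul_pos hα h1).le
      linarith
  have hlim : Tendsto g (𝓝[>] 0) (𝓝 0) := by
    have h1 : Tendsto (fun t => (σ * (Real.exp (σ * t) - 1)) ^ α) (𝓝[>] 0) (𝓝 0) := by
      have : ContinuousAt (fun t => (σ * (Real.exp (σ * t) - 1)) ^ α) 0 := by
        apply ContinuousAt.rpow_const (by fun_prop) (Or.inr hα.le)
      have h2 := this.tendsto
      simp only [mul_zero, Real.exp_zero, sub_self, Real.zero_rpow hα.ne'] at h2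
      exact h2.mono_left nhdsWithin_le_nhds
    have h2 : Tendsto Real.exp (𝓝[>] 0) (𝓝 1) := by
      have := Real.continuous_exp.tendsto 0
      rw [Real.exp_zero] at this
      exact this.mono_left nhdsWithin_le_nhds
    simpa using ((hD0.const_mul α).mul h2).sub h1
  have : 0 ≤ g t := by
    apply le_of_tendsto hlim
    filter_upwards [Ioo_mem_nhdsGT ht] with x hx
    exact hmono hx.1 ht hx.2.le
  linarith

theorem tendsto_log_mgf (hZ : IsUrnChain μ (fun n => α * n) k₀ Z) (hα : 0 < α) (hk : 0 ≤ k₀)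
    {σ : ℝ} (hσ : σ = 1 ∨ σ = -1) {D : ℝ → ℝ}
    (hD : ∀ t, 0 < t → HasDerivAt D
      ((σ * (Real.exp (σ * t) - 1)) ^ α / (σ * (Real.exp (σ * t) - 1))) t)
    (hD0 : Tendsto D (𝓝[>] 0) (𝓝 0)) {t : ℝ} (ht : 0 < t) :
    Tendsto (fun n : ℕ => 1 / (n : ℝ) * Real.log (mgf (Z n) μ (σ * t))) atTop
      (𝓝 (Real.log ((σ * (Real.exp (σ * t) - 1)) ^ α / (α * D t)))) := by
  have H := hZ.isDividedDerivSeq hα hσ hD hD0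
  have habs : ∀ x, |σ * x| = |x| := by rcases hσ with rfl | rfl <;> simp
  have hw := sign_mul_exp_sub_one_pos hσ ht
  have hh : 0 < (σ * (Real.exp (σ * t) - 1)) ^ α := by positivity
  have hDt := H.var_pos ht
  have hQ : ∃ Q : ℝ, 1 ≤ Q ∧ Real.exp t * (α / (σ * (Real.exp (σ * t) - 1)) ^ α) ≤ Q ∧
      Real.exp t * ((σ * (Real.exp (σ * t) - 1)) ^ α / α) ≤ Q :=
    ⟨max 1 (max _ _), le_max_left _ _, (le_max_left _ _).trans (le_max_right _ _),
      (le_max_right _ _).trans (le_max_right _ _)⟩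
  obtain ⟨Q, hQ1, hQ2, hQ3⟩ := hQ
  have hlog := H.tendsto_log_div ht hQ1 ?_ ?_ ?_
  · rw [← tendsto_add_atTop_iff_nat 1]
    set h := (σ * (Real.exp (σ * t) - 1)) ^ α with hh_def
    have hr : Tendsto (fun n : ℕ => (n : ℝ) / (n + 1)) atTop (𝓝 1) :=
      tendsto_natCast_div_add_atTop 1
    have hfin := ((hlog.mul hr).add_const (Real.log h)).sub (hr.mul_const (Real.log α))
    have e : -Real.log (D t) * 1 + Real.log h - 1 * Real.log α = Real.log (h / (α * D t)) := by
      rw [Real.log_div hh.ne' (by positivity), Real.log_mul hα.ne' hDt.ne']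
      ring
    rw [e] at hfin
    refine hfin.congr' ?_
    filter_upwards [eventually_gt_atTop 0] with n hn
    have hn' : (0 : ℝ) < n := by exact_mod_cast hn
    have hM := hZ.mgf_pos' (n := n + 1) (by omega) (σ * t)
    rw [Real.log_div (by positivity) (by positivity), Real.log_mul (by positivity) hM.ne',
      Real.log_pow, Real.log_pow]
    push_cast
    field_simp
    ring
  · intro n
    have hM := hZ.mgf_pos' (n := n + 1) (by omega) (σ * t)
    have h1 := (hZ.mgf_succ_le (n := n + 1) (by omega) (σ * t)).1
    rw [habs, abs_of_pos ht] at h1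
    set h := (σ * (Real.exp (σ * t) - 1)) ^ α with hh_def
    calc _ ≤ α ^ (n + 1) * (Real.exp t * mgf (Z (n + 1)) μ (σ * t)) / h ^ (n + 1 + 1) := by gcongr
      _ = (Real.exp t * (α / h)) * (α ^ n * mgf (Z (n + 1)) μ (σ * t) / h ^ (n + 1)) := by
        field_simp
        ring
      _ ≤ _ := by gcongr
  · intro n
    have hM := hZ.mgf_pos' (n := n + 2) (by omega) (σ * t)
    have h1 := (hZ.mgf_succ_le (n := n + 1) (by omega) (σ * t)).2
    rw [habs, abs_of_pos ht] at h1
    set h := (σ * (Real.exp (σ * t) - 1)) ^ α with hh_def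
    calc _ ≤ α ^ n * (Real.exp t * mgf (Z (n + 1 + 1)) μ (σ * t)) / h ^ (n + 1) := by gcongr
      _ = (Real.exp t * (h / α)) *
          (α ^ (n + 1) * mgf (Z (n + 1 + 1)) μ (σ * t) / h ^ (n + 1 + 1)) := by
        field_simp
        ring
      _ ≤ _ := by gcongr
  · intro u hu
    have hwu := sign_mul_exp_sub_one_pos hσ hu
    have hbound := rpow_le_mul_exp hσ hα hD (fun t => H.var_pos) hD0 hu
    have hDu := H.var_pos hu
    have hhu : 0 < (σ * (Real.exp (σ * u) - 1)) ^ α := by positivity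
    set h := (σ * (Real.exp (σ * u) - 1)) ^ α with hh_def
    -- One factor e^{-u} per step comes from Z ≤ k₀ + n, the other from h ≤ α D e^u.
    refine ⟨Real.exp (-(u * (k₀ + 1))) / h, by positivity, fun n => ?_⟩
    have hM := hZ.exp_le_mgf hk (n := n + 1) (by omega) (σ * u)
    rw [habs, abs_of_pos hu] at hM
    have hM0 := hZ.mgf_pos' (n := n + 1) (by omega) (σ * u)
    calc _ = α ^ n * Real.exp (-(u * (k₀ + ((n + 1 : ℕ) : ℝ)))) /
            (h * (α * D u * Real.exp u) ^ n) := by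
          have e1 : Real.exp (-(u * (k₀ + ((n + 1 : ℕ) : ℝ)))) =
              Real.exp (-(u * (k₀ + 1))) * Real.exp (-(2 * u)) ^ n * Real.exp u ^ n := by
            rw [← Real.exp_nat_mul, ← Real.exp_nat_mul, ← Real.exp_add, ← Real.exp_add]
            congr 1
            push_cast
            ring
          rw [e1, mul_pow, mul_pow, div_pow]
          field_simp
      _ ≤ α ^ n * mgf (Z (n + 1)) μ (σ * u) / (h * h ^ n) := by gcongr
      _ = _ := by rw [pow_succ' h]

end IsUrnChain

/-! ### Smoothness of the closed forms across 0. -/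

lemma analyticAt_dslope {f : ℝ → ℝ} (hf : ∀ x, AnalyticAt ℝ f x) (a x : ℝ) :
    AnalyticAt ℝ (dslope f a) x := by
  rcases eq_or_ne x a with rfl | h
  · obtain ⟨p, hp⟩ := hf x
    exact ⟨_, hp.has_fpower_series_dslope_fslope⟩
  · have h1 : AnalyticAt ℝ (fun y => (y - a)⁻¹ • (f y - f a)) x :=
      ((analyticAt_id.sub analyticAt_const).inv (sub_ne_zero.2 h)).smul
        ((hf x).sub analyticAt_const)
    refine h1.congr ?_
    filter_upwards [isOpen_ne.mem_nhds h] with y hy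
    rw [dslope_of_ne f hy, slope, vsub_eq_sub]

lemma hasDerivAt_artanh {x : ℝ} (hx : x ∈ Set.Ioo (-1 : ℝ) 1) :
    HasDerivAt Real.artanh (1 / (1 - x ^ 2)) x := by
  have h1 : 0 < 1 + x := by linarith [hx.1]
  have h2 : 0 < 1 - x := by linarith [hx.2]
  have hd : HasDerivAt (fun x : ℝ => 1 / 2 * (Real.log (1 + x) - Real.log (1 - x)))
      (1 / (1 - x ^ 2)) x := by
    refine (((((hasDerivAt_id x).const_add 1).log h1.ne').sub
      (((hasDerivAt_id x).const_sub 1).log h2.ne')).const_mul (1 / 2)).congr_deriv ?_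
    have h3 : 1 - x ^ 2 ≠ 0 := by
      have : 1 - x ^ 2 = (1 + x) * (1 - x) := by ring
      rw [this]
      positivity
    simp only [id]
    field_simp
    ring
  refine hd.congr_of_eventuallyEq ?_
  filter_upwards [isOpen_Ioo.mem_nhds hx] with y hy
  have h1 : 0 < 1 + y := by linarith [hy.1]
  have h2 : 0 < 1 - y := by linarith [hy.2]
  rw [Real.artanh_eq_half_log ⟨hy.1.le, hy.2.le⟩, Real.log_div h1.ne' h2.ne']

/-- The analytic function on `(-1, ∞)` with value `arctan √x / √x` for `x > 0`. -/
noncomputable def arctanSqrtDiv (x : ℝ) : ℝ :=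
  if 0 < x then Real.arctan √x / √x else if x < 0 then Real.artanh √(-x) / √(-x) else 1

lemma arctanSqrtDiv_of_pos {x : ℝ} (hx : 0 < x) :
    arctanSqrtDiv x = Real.arctan √x / √x := if_pos hx

lemma arctanSqrtDiv_of_neg {x : ℝ} (hx : x < 0) :
    arctanSqrtDiv x = Real.artanh √(-x) / √(-x) := by
  rw [arctanSqrtDiv, if_neg hx.le.not_gt, if_pos hx]

lemma arctanSqrtDiv_zero : arctanSqrtDiv 0 = 1 := by simp [arctanSqrtDiv]

lemma sqrt_neg_mem_Ioo {x : ℝ} (hx : -1 < x) (hx0 : x < 0) : √(-x) ∈ Set.Ioo (0 : ℝ) 1 :=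
  ⟨Real.sqrt_pos.2 (by linarith), by rw [Real.sqrt_lt' one_pos]; linarith⟩

lemma arctanSqrtDiv_pos {x : ℝ} (hx : -1 < x) : 0 < arctanSqrtDiv x := by
  rcases lt_trichotomy x 0 with h | rfl | h
  · rw [arctanSqrtDiv_of_neg h]
    have hm := sqrt_neg_mem_Ioo hx h
    exact div_pos (Real.artanh_pos hm) hm.1
  · simp [arctanSqrtDiv_zero]
  · rw [arctanSqrtDiv_of_pos h]
    have := Real.sqrt_pos.2 h
    exact div_pos (Real.arctan_pos.2 this) this

/-- The arctan series at √x and the artanh series at √(-x) give the same power series in x, which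
glues the two branches analytically at 0. -/
lemma hasSum_arctanSqrtDiv {x : ℝ} (hx : |x| < 1) :
    HasSum (fun k : ℕ => ((-1) ^ k / (2 * k + 1) : ℝ) * x ^ k) (arctanSqrtDiv x) := by
  obtain ⟨hx1, hx2⟩ := abs_lt.1 hx
  rcases lt_trichotomy x 0 with h | rfl | h
  · have hm := sqrt_neg_mem_Ioo hx1 h
    have hs : √(-x) ^ 2 = -x := Real.sq_sqrt (by linarith)
    have hsum := (Real.hasSum_log_sub_log_of_abs_lt_one
      (x := √(-x)) (by rw [abs_of_pos hm.1]; exact hm.2)).mul_left (1 / (2 * √(-x)))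
    rw [arctanSqrtDiv_of_neg h, Real.artanh_eq_half_log ⟨by linarith [hm.1], hm.2.le⟩,
      Real.log_div (by linarith [hm.1]) (by linarith [hm.2])]
    have hm0 := hm.1.ne'
    convert! hsum using 1
    · ext k
      rw [pow_succ √(-x), pow_mul, hs, neg_pow x]
      field_simp
    · field_simp
  · rw [arctanSqrtDiv_zero]
    convert! hasSum_single (f := fun k : ℕ => ((-1) ^ k / (2 * k + 1) : ℝ) * 0 ^ k) 0 ?_ using 1
    · simp
    · intro k hk
      simp [hk]
  · have hs0 := Real.sqrt_pos.2 h
    have hs : √x ^ 2 = x := Real.sq_sqrt h.le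
    have hs1 : ‖√x‖ < 1 := by
      rw [Real.norm_of_nonneg hs0.le, Real.sqrt_lt' one_pos]; linarith
    have hsum := (Real.hasSum_arctan hs1).mul_left (1 / √x)
    rw [arctanSqrtDiv_of_pos h]
    convert! hsum using 1
    · ext k
      rw [pow_succ √x, pow_mul, hs]
      push_cast
      field_simp
    · field_simp

lemma analyticAt_arctanSqrtDiv_zero : AnalyticAt ℝ arctanSqrtDiv 0 := by
  set c : ℕ → ℝ := fun k => (-1) ^ k / (2 * k + 1)
  refine ⟨FormalMultilinearSeries.ofScalars ℝ c, 1, ?_, one_pos, ?_⟩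
  · have := (FormalMultilinearSeries.ofScalars ℝ c).le_radius_of_bound (r := 1) 1 fun n => by
      rw [FormalMultilinearSeries.ofScalars_norm]
      simp only [c, norm_div, norm_pow, norm_neg, norm_one, one_pow, NNReal.coe_one, mul_one]
      rw [Real.norm_of_nonneg (by positivity)]
      exact div_le_one_of_le₀ (by linarith [(Nat.cast_nonneg n : (0 : ℝ) ≤ n)]) (by positivity)
    simpa using this
  · intro y hy
    have hy' : ‖y‖ₑ < 1 := by simpa using hy
    rw [← ofReal_norm, ENNReal.ofReal_lt_one, Real.norm_eq_abs] at hy'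
    simp only [zero_add, FormalMultilinearSeries.ofScalars_apply_eq, smul_eq_mul]
    exact hasSum_arctanSqrtDiv hy'

lemma contDiffAt_arctanSqrtDiv {n : ℕ∞} {x : ℝ} (hx : -1 < x) :
    ContDiffAt ℝ n arctanSqrtDiv x := by
  rcases lt_trichotomy x 0 with h | rfl | h
  · have hm := sqrt_neg_mem_Ioo hx h
    have hsq : ContDiffAt ℝ n (fun y : ℝ => √(-y)) x :=
      contDiffAt_id.neg.sqrt (by simpa using h.ne)
    have hf : ContDiffAt ℝ n (fun y : ℝ =>
        1 / 2 * (Real.log (1 + √(-y)) - Real.log (1 - √(-y))) / √(-y)) x :=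
      (contDiffAt_const.mul (((contDiffAt_const.add hsq).log (by linarith [hm.1])).sub
        ((contDiffAt_const.sub hsq).log (by linarith [hm.2])))).div hsq hm.1.ne'
    refine hf.congr_of_eventuallyEq ?_
    filter_upwards [isOpen_Ioo.mem_nhds (⟨hx, h⟩ : x ∈ Set.Ioo (-1) 0)] with y hy
    have hmy := sqrt_neg_mem_Ioo hy.1 hy.2
    rw [arctanSqrtDiv_of_neg hy.2, Real.artanh_eq_half_log ⟨by linarith [hmy.1], hmy.2.le⟩,
      Real.log_div (by linarith [hmy.1]) (by linarith [hmy.2])]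
  · exact analyticAt_arctanSqrtDiv_zero.contDiffAt
  · have hsq : ContDiffAt ℝ n (fun y : ℝ => √y) x := contDiffAt_id.sqrt h.ne'
    have hf : ContDiffAt ℝ n (fun y : ℝ => Real.arctan √y / √y) x :=
      hsq.arctan.div hsq (Real.sqrt_pos.2 h).ne'
    refine hf.congr_of_eventuallyEq ?_
    filter_upwards [isOpen_Ioi.mem_nhds h] with y hy
    exact arctanSqrtDiv_of_pos hy

theorem exists_rate_half : ∃ Λ : ℝ → ℝ, ContDiff ℝ (⊤ : ℕ∞) Λ ∧ Λ 0 = 0 ∧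
    (∀ t : ℝ, 0 < t → Λ t =
      Real.log (√(Real.exp t - 1) / Real.arctan √(Real.exp t - 1))) ∧
    (∀ t : ℝ, t < 0 → Λ t =
      Real.log (√(1 - Real.exp t) / Real.artanh √(1 - Real.exp t))) := by
  refine ⟨fun t => -Real.log (arctanSqrtDiv (Real.exp t - 1)), ?_, ?_, ?_, ?_⟩
  · rw [contDiff_iff_contDiffAt]
    intro t
    have h : -1 < Real.exp t - 1 := by linarith [Real.exp_pos t]
    have hc : ContDiffAt ℝ (⊤ : ℕ∞) (fun t => arctanSqrtDiv (Real.exp t - 1)) t :=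
      ContDiffAt.comp t (contDiffAt_arctanSqrtDiv h)
        (Real.contDiff_exp.contDiffAt.sub contDiffAt_const)
    exact (hc.log (arctanSqrtDiv_pos h).ne').neg
  · simp [arctanSqrtDiv_zero]
  · intro t ht
    have h : 0 < Real.exp t - 1 := by linarith [Real.one_lt_exp_iff.2 ht]
    beta_reduce
    rw [arctanSqrtDiv_of_pos h, ← Real.log_inv, inv_div]
  · intro t ht
    have h : Real.exp t - 1 < 0 := by linarith [Real.exp_lt_one_iff.2 ht]
    beta_reduce
    rw [arctanSqrtDiv_of_neg h, ← Real.log_inv, inv_div, neg_sub]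

/-- The entire function `(exp t - 1) / t`. -/
noncomputable def expSlope : ℝ → ℝ := dslope (fun x => Real.exp x - 1) 0

lemma analyticAt_expSlope (t : ℝ) : AnalyticAt ℝ expSlope t :=
  analyticAt_dslope (fun _ => analyticAt_rexp.sub analyticAt_const) 0 t

lemma expSlope_zero : expSlope 0 = 1 := by
  rw [expSlope, dslope_same]
  simp

lemma expSlope_of_ne {t : ℝ} (ht : t ≠ 0) : expSlope t = (Real.exp t - 1) / t := by
  rw [expSlope, dslope_of_ne _ ht, slope_def_field]
  simp

lemma expSlope_pos (t : ℝ) : 0 < expSlope t := by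
  rcases lt_trichotomy t 0 with h | rfl | h
  · rw [expSlope_of_ne h.ne]
    exact div_pos_of_neg_of_neg (by linarith [Real.exp_lt_one_iff.2 h]) h
  · simp [expSlope_zero]
  · rw [expSlope_of_ne h.ne']
    exact div_pos (by linarith [Real.one_lt_exp_iff.2 h]) h

lemma dslope_expSlope_of_ne {t : ℝ} (ht : t ≠ 0) :
    dslope expSlope 0 t = (Real.exp t - 1 - t) / t ^ 2 := by
  rw [dslope_of_ne _ ht, slope_def_field, expSlope_of_ne ht, expSlope_zero]
  field_simp
  ring

/-- By continuity the value is the limit of (e^t - 1 - t)/t², read off from the third-order Taylor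
bound for exp. -/
lemma dslope_expSlope_zero : dslope expSlope 0 0 = 1 / 2 := by
  have hc : Tendsto (dslope expSlope 0) (𝓝[≠] 0) (𝓝 (dslope expSlope 0 0)) :=
    (analyticAt_dslope analyticAt_expSlope 0 0).continuousAt.tendsto.mono_left
      nhdsWithin_le_nhds
  refine tendsto_nhds_unique hc ?_
  rw [tendsto_iff_norm_sub_tendsto_zero]
  have hlim : Tendsto (fun t : ℝ => |t|) (𝓝[≠] 0) (𝓝 0) := by
    have := (continuous_abs : Continuous fun t : ℝ => |t|).tendsto 0
    rw [abs_zero] at this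
    exact this.mono_left nhdsWithin_le_nhds
  refine squeeze_zero' (Eventually.of_forall fun _ => norm_nonneg _) ?_ hlim
  have hball : Set.Ioo (-1 : ℝ) 1 ∈ 𝓝[≠] (0 : ℝ) :=
    nhdsWithin_le_nhds (isOpen_Ioo.mem_nhds ⟨by norm_num, by norm_num⟩)
  filter_upwards [hball, self_mem_nhdsWithin] with t ht ht0
  have ht0 : t ≠ 0 := ht0
  have hb := Real.exp_bound (x := t) (abs_le.2 ⟨ht.1.le, ht.2.le⟩) (n := 3) (by norm_num)
  rw [dslope_expSlope_of_ne ht0, Real.norm_eq_abs]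
  have e : (Real.exp t - 1 - t) / t ^ 2 - 1 / 2 =
      (Real.exp t - ∑ m ∈ Finset.range 3, t ^ m / m.factorial) / t ^ 2 := by
    simp only [Finset.sum_range_succ, Finset.sum_range_zero, Nat.factorial]
    field_simp
    ring
  rw [e, abs_div, abs_of_nonneg (sq_nonneg t), div_le_iff₀ (by positivity)]
  refine hb.trans ?_
  rw [← sq_abs t, ← pow_succ']
  have : (0 : ℝ) ≤ |t| ^ 3 := by positivity
  norm_num [Nat.factorial]
  linarith

lemma dslope_expSlope_pos (t : ℝ) : 0 < dslope expSlope 0 t := by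
  rcases eq_or_ne t 0 with rfl | h
  · rw [dslope_expSlope_zero]; norm_num
  · rw [dslope_expSlope_of_ne h]
    have := Real.add_one_lt_exp h
    exact div_pos (by linarith) (by positivity)

theorem exists_rate_one : ∃ Λ : ℝ → ℝ, ContDiff ℝ (⊤ : ℕ∞) Λ ∧ Λ 0 = 0 ∧
    ∀ t : ℝ, t ≠ 0 → Λ t = Real.log ((Real.exp t - 1) / t) := by
  refine ⟨fun t => Real.log (expSlope t), ?_, ?_, ?_⟩
  · rw [contDiff_iff_contDiffAt]
    exact fun t => (analyticAt_expSlope t).contDiffAt.log (expSlope_pos t).ne'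
  · simp [expSlope_zero]
  · intro t ht
    beta_reduce
    rw [expSlope_of_ne ht]

theorem exists_rate_two : ∃ Λ : ℝ → ℝ, ContDiff ℝ (⊤ : ℕ∞) Λ ∧ Λ 0 = 0 ∧
    ∀ t : ℝ, t ≠ 0 → Λ t =
      Real.log ((Real.exp t - 1) ^ 2 / (2 * (Real.exp t - 1 - t))) := by
  refine ⟨fun t => Real.log (expSlope t ^ 2 / (2 * dslope expSlope 0 t)), ?_, ?_, ?_⟩
  · rw [contDiff_iff_contDiffAt]
    intro t
    have h1 := expSlope_pos t
    have h2 := dslope_expSlope_pos t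
    exact (((analyticAt_expSlope t).contDiffAt.pow 2).div
      (contDiffAt_const.mul (analyticAt_dslope analyticAt_expSlope 0 t).contDiffAt)
      (mul_pos two_pos h2).ne').log (div_pos (pow_pos h1 2) (mul_pos two_pos h2)).ne'
  · beta_reduce
    rw [expSlope_zero, dslope_expSlope_zero]
    norm_num
  · intro t ht
    beta_reduce
    have : Real.exp t - 1 - t ≠ 0 := by
      have := Real.add_one_lt_exp ht
      exact (by linarith : 0 < Real.exp t - 1 - t).ne'
    rw [expSlope_of_ne ht, dslope_expSlope_of_ne ht]
    congr 1
    field_simp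

/-! ### The three values of α. -/

namespace IsUrnChain

variable {Ω : Type*} [mΩ : MeasurableSpace Ω] {μ : Measure Ω} [IsProbabilityMeasure μ]
  {α k₀ : ℝ} {Z : ℕ → Ω → ℝ}

theorem tendsto_log_mgf_of_forall (hZ : IsUrnChain μ (fun n => α * n) k₀ Z) (hα : 0 < α)
    (hk : 0 ≤ k₀) {D : ℝ → ℝ → ℝ} {Λ : ℝ → ℝ} (h0 : Λ 0 = 0)
    (hD : ∀ σ : ℝ, (σ = 1 ∨ σ = -1) → ∀ t, 0 < t → HasDerivAt (D σ)
      ((σ * (Real.exp (σ * t) - 1)) ^ α / (σ * (Real.exp (σ * t) - 1))) t)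
    (hD0 : ∀ σ : ℝ, (σ = 1 ∨ σ = -1) → ContinuousAt (D σ) 0 ∧ D σ 0 = 0)
    (hΛ : ∀ σ : ℝ, (σ = 1 ∨ σ = -1) → ∀ t, 0 < t →
      Λ (σ * t) = Real.log ((σ * (Real.exp (σ * t) - 1)) ^ α / (α * D σ t))) (t : ℝ) :
    Tendsto (fun n : ℕ => 1 / (n : ℝ) * Real.log (∫ ω, Real.exp (t * Z n ω) ∂μ)) atTop
      (𝓝 (Λ t)) := by
  have key : ∀ σ : ℝ, (σ = 1 ∨ σ = -1) → ∀ t, 0 < t →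
      Tendsto (fun n : ℕ => 1 / (n : ℝ) * Real.log (∫ ω, Real.exp ((σ * t) * Z n ω) ∂μ)) atTop
        (𝓝 (Λ (σ * t))) := by
    intro σ hσ t ht
    rw [hΛ σ hσ t ht]
    refine hZ.tendsto_log_mgf hα hk hσ (hD σ hσ) ?_ ht
    have := (hD0 σ hσ).1.tendsto
    rw [(hD0 σ hσ).2] at this
    exact this.mono_left nhdsWithin_le_nhds
  rcases lt_trichotomy t 0 with h | rfl | h
  · simpa using key (-1) (Or.inr rfl) (-t) (by linarith)
  · simp [h0]
  · simpa using key 1 (Or.inl rfl) t h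

theorem tendsto_log_mgf_one (hZ : IsUrnChain μ (fun n => (1 : ℝ) * n) k₀ Z) (hk : 0 ≤ k₀)
    {Λ : ℝ → ℝ} (h0 : Λ 0 = 0) (hΛ : ∀ t : ℝ, t ≠ 0 → Λ t = Real.log ((Real.exp t - 1) / t))
    (t : ℝ) :
    Tendsto (fun n : ℕ => 1 / (n : ℝ) * Real.log (∫ ω, Real.exp (t * Z n ω) ∂μ)) atTop
      (𝓝 (Λ t)) := by
  refine hZ.tendsto_log_mgf_of_forall one_pos hk (D := fun _ t => t) h0 ?_ ?_ ?_ t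
  · intro σ hσ t ht
    refine (hasDerivAt_id t).congr_deriv ?_
    rw [Real.rpow_one, div_self (sign_mul_exp_sub_one_pos hσ ht).ne']
  · exact fun σ _ => ⟨continuousAt_id, rfl⟩
  · intro σ hσ t ht
    have hσ0 : σ ≠ 0 := by rcases hσ with rfl | rfl <;> norm_num
    rw [hΛ _ (mul_ne_zero hσ0 ht.ne'), Real.rpow_one]
    rcases hσ with rfl | rfl
    · simp
    · congr 1
      field_simp

theorem tendsto_log_mgf_two (hZ : IsUrnChain μ (fun n => (2 : ℝ) * n) k₀ Z) (hk : 0 ≤ k₀)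
    {Λ : ℝ → ℝ} (h0 : Λ 0 = 0)
    (hΛ : ∀ t : ℝ, t ≠ 0 → Λ t =
      Real.log ((Real.exp t - 1) ^ 2 / (2 * (Real.exp t - 1 - t)))) (t : ℝ) :
    Tendsto (fun n : ℕ => 1 / (n : ℝ) * Real.log (∫ ω, Real.exp (t * Z n ω) ∂μ)) atTop
      (𝓝 (Λ t)) := by
  refine hZ.tendsto_log_mgf_of_forall two_pos hk
    -- For α = 2, D' = w = σ(e^{σt} - 1).
    (D := fun σ t => Real.exp (σ * t) - 1 - σ * t) h0 ?_ ?_ ?_ t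
  · intro σ hσ t ht
    have hw := sign_mul_exp_sub_one_pos hσ ht
    refine (((((hasDerivAt_id t).const_mul σ).exp).sub_const 1).sub
      ((hasDerivAt_id t).const_mul σ)).congr_deriv ?_
    rw [Real.rpow_two, sq, mul_div_assoc, div_self hw.ne']
    simp only [id]
    ring
  · exact fun σ _ => ⟨by fun_prop, by simp⟩
  · intro σ hσ t ht
    have hσ0 : σ ≠ 0 := by rcases hσ with rfl | rfl <;> norm_num
    have hσ2 : σ ^ 2 = 1 := by rcases hσ with rfl | rfl <;> norm_num
    rw [hΛ _ (mul_ne_zero hσ0 ht.ne'), Real.rpow_two, mul_pow, hσ2, one_mul]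

theorem tendsto_log_mgf_half (hZ : IsUrnChain μ (fun n => (1 / 2 : ℝ) * n) k₀ Z) (hk : 0 ≤ k₀)
    {Λ : ℝ → ℝ} (h0 : Λ 0 = 0)
    (hΛpos : ∀ t : ℝ, 0 < t → Λ t =
      Real.log (√(Real.exp t - 1) / Real.arctan √(Real.exp t - 1)))
    (hΛneg : ∀ t : ℝ, t < 0 → Λ t =
      Real.log (√(1 - Real.exp t) / Real.artanh √(1 - Real.exp t))) (t : ℝ) :
    Tendsto (fun n : ℕ => 1 / (n : ℝ) * Real.log (∫ ω, Real.exp (t * Z n ω) ∂μ)) atTop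
      (𝓝 (Λ t)) := by
  have hne : (-1 : ℝ) ≠ 1 := by norm_num
  refine hZ.tendsto_log_mgf_of_forall one_half_pos hk
    -- For α = 1/2, D' = 1/√w. Since e^{σt} = 1 + σw, the substitution y = √w turns the integral
    -- into that of 2/(1 + σy²).
    (D := fun σ t => if σ = 1 then 2 * Real.arctan √(σ * (Real.exp (σ * t) - 1)) else
      2 * Real.artanh √(σ * (Real.exp (σ * t) - 1))) h0 ?_ ?_ ?_ t
  · intro σ hσ t ht
    have hw := sign_mul_exp_sub_one_pos hσ ht
    have hsq := (hasDerivAt_sign_mul_exp_sub_one hσ t).sqrt hw.ne'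
    have hs0 := Real.sqrt_pos.2 hw
    have hss := Real.sq_sqrt hw.le
    rw [← Real.sqrt_eq_rpow]
    have e : √(σ * (Real.exp (σ * t) - 1)) / (σ * (Real.exp (σ * t) - 1)) =
        1 / √(σ * (Real.exp (σ * t) - 1)) := by
      rw [div_eq_div_iff hw.ne' hs0.ne', ← sq, hss, one_mul]
    rw [e]
    have hexp := Real.exp_pos (σ * t)
    rcases hσ with rfl | rfl
    · simp only [if_true]
      refine (hsq.arctan.const_mul 2).congr_deriv ?_
      rw [hss]
      have : 1 + 1 * (Real.exp (1 * t) - 1) = Real.exp (1 * t) := by ring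
      rw [this]
      field_simp
    · simp only [if_neg hne]
      have hmem : √(-1 * (Real.exp (-1 * t) - 1)) ∈ Set.Ioo (-1 : ℝ) 1 := by
        refine ⟨by linarith, ?_⟩
        rw [Real.sqrt_lt' one_pos]
        linarith
      refine (((hasDerivAt_artanh hmem).comp t hsq).const_mul 2).congr_deriv ?_
      rw [hss]
      have : 1 - -1 * (Real.exp (-1 * t) - 1) = Real.exp (-1 * t) := by ring
      rw [this]
      field_simp
  · intro σ hσ
    rcases hσ with rfl | rfl
    · simp only [if_true]
      exact ⟨by fun_prop, by simp⟩
    · simp only [if_neg hne]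
      refine ⟨?_, by simp⟩
      have h1 : ContinuousAt Real.artanh √(-1 * (Real.exp (-1 * (0 : ℝ)) - 1)) := by
        simpa using (hasDerivAt_artanh (x := 0) (by norm_num)).continuousAt
      have h2 : ContinuousAt (fun t : ℝ => √(-1 * (Real.exp (-1 * t) - 1))) 0 := by fun_prop
      exact (ContinuousAt.comp (f := fun t : ℝ => √(-1 * (Real.exp (-1 * t) - 1))) h1 h2).const_mul 2
  · intro σ hσ t ht
    rw [← Real.sqrt_eq_rpow]
    rcases hσ with rfl | rfl
    · simp only [if_true]
      rw [hΛpos _ (by linarith), ← mul_assoc]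
      norm_num
    · simp only [if_neg hne]
      rw [hΛneg _ (by linarith), ← mul_assoc]
      norm_num

end IsUrnChain

theorem proposition2p1 (α k₀ : ℝ) (hα : α = 1 / 2 ∨ α = 1 ∨ α = 2)
    (hk₀ : 0 ≤ k₀) (hk₁ : k₀ ≤ α)
    {Ω : Type*} [MeasurableSpace Ω] (μ : Measure Ω) [IsProbabilityMeasure μ]
    (Z : ℕ → Ω → ℝ) (hZ : IsUrnChain μ (fun n => α * n) k₀ Z) :
    (∀ (t : ℝ) (n : ℕ), 1 ≤ n → Integrable (fun ω => Real.exp (t * Z n ω)) μ) ∧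
    ∃ Λ : ℝ → ℝ,
      (∀ t : ℝ, Tendsto (fun n : ℕ => 1 / (n : ℝ) * Real.log (∫ ω, Real.exp (t * Z n ω) ∂μ))
        atTop (𝓝 (Λ t))) ∧
      ContDiff ℝ (⊤ : ℕ∞) Λ ∧
      Λ 0 = 0 ∧
      (α = 1 / 2 →
        (∀ t : ℝ, 0 < t → Λ t =
          Real.log (√(Real.exp t - 1) / Real.arctan √(Real.exp t - 1))) ∧
        (∀ t : ℝ, t < 0 → Λ t =
          Real.log (√(1 - Real.exp t) / Real.artanh √(1 - Real.exp t)))) ∧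
      (α = 1 → ∀ t : ℝ, t ≠ 0 → Λ t = Real.log ((Real.exp t - 1) / t)) ∧
      (α = 2 → ∀ t : ℝ, t ≠ 0 → Λ t =
        Real.log ((Real.exp t - 1) ^ 2 / (2 * (Real.exp t - 1 - t)))) := by
  refine ⟨fun t n hn => hZ.integrable_exp hn t, ?_⟩
  rcases hα with rfl | rfl | rfl
  · obtain ⟨Λ, hsmooth, h0, hpos, hneg⟩ := exists_rate_half
    exact ⟨Λ, hZ.tendsto_log_mgf_half hk₀ h0 hpos hneg, hsmooth, h0, fun _ => ⟨hpos, hneg⟩,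
      fun h => by norm_num at h, fun h => by norm_num at h⟩
  · obtain ⟨Λ, hsmooth, h0, hΛ⟩ := exists_rate_one
    exact ⟨Λ, hZ.tendsto_log_mgf_one hk₀ h0 hΛ, hsmooth, h0, fun h => by norm_num at h,
      fun _ => hΛ, fun h => by norm_num at h⟩
  · obtain ⟨Λ, hsmooth, h0, hΛ⟩ := exists_rate_two
    exact ⟨Λ, hZ.tendsto_log_mgf_two hk₀ h0 hΛ, hsmooth, h0, fun h => by norm_num at h,
      fun h => by norm_num at h, fun _ => hΛ⟩
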